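/- For a finite set $S$ of points in the plane, let $w^*(S)$ be the infimum, over all pairs of slabs whose union covers $S$, of the maximum of the two widths. (A slab is the closed region between two parallel lines, which may coincide; its width is the distance between these lines.) There are a deterministic algorithm, in a unit-cost model with exact real arithmetic (addition, subtraction, multiplication, division and comparison of real numbers, creation and inspection of linked two-field records, and recursive calls, each at cost $1$), and a constant $C$ such that, for every $n\ge 1$ and every set $S$ of $n$ points in the plane, given as a list of its points in any order, the algorithm halts after at most $Cn$ steps and outputs a pair of slabs whose union covers $S$ and whose maximum width is at most $10\,w^*(S)$. -/

import Mathlib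

/-! ## Slabs and the two-line-center problem

Points of the plane are pairs of real coordinates. -/

namespace TwoLineCenter

/-- A slab: the closed region `lo ≤ a x + b y ≤ hi` between the two parallel lines
`a x + b y = lo` and `a x + b y = hi`. The two lines may coincide, and then the slab is a line.
The normal vector `(a, b)` is not assumed to be normalised. -/
structure Slab where
  a : ℝ
  b : ℝ
  lo : ℝ
  hi : ℝ
  normal_ne_zero : a ≠ 0 ∨ b ≠ 0
  lo_le_hi : lo ≤ hi

/-- The set of points of a slab. -/
def Slab.region (σ : Slab) : Set (ℝ × ℝ) :=
  {p | σ.lo ≤ σ.a * p.1 + σ.b * p.2 ∧ σ.a * p.1 + σ.b * p.2 ≤ σ.hi}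

/-- The width of a slab: the Euclidean distance between its two bounding lines. -/
noncomputable def Slab.width (σ : Slab) : ℝ :=
  (σ.hi - σ.lo) / Real.sqrt (σ.a ^ 2 + σ.b ^ 2)

/-- The union of the two slabs covers `S`. -/
def Covers (σ₁ σ₂ : Slab) (S : Set (ℝ × ℝ)) : Prop :=
  S ⊆ σ₁.region ∪ σ₂.region

/-- The maximum width of a pair of slabs. -/
noncomputable def maxWidth (σ₁ σ₂ : Slab) : ℝ :=
  max σ₁.width σ₂.width

/-- The optimal value `w*` of the (general) two-line-center problem for `S`: the infimum of the
maximum width over all pairs of slabs whose union covers `S`. -/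
noncomputable def optWidth (S : Set (ℝ × ℝ)) : ℝ :=
  sInf {w : ℝ | ∃ σ₁ σ₂ : Slab, Covers σ₁ σ₂ S ∧ w = maxWidth σ₁ σ₂}

end TwoLineCenter

/-! ## The model of computation

A unit-cost model with exact real arithmetic: first-order recursive programs over linked data
(in the style of pure LISP). A data item is a real number, the empty list, or a reference to an
immutable two-field record. The operations are field arithmetic on reals, comparison of two
reals, allocation and inspection of records, local definitions, and calls of the (mutually
recursive) functions of the program, each at cost `1`. There is no rounding, no square root, no
random access and no test that inspects more than one record or two reals.

A program is a finite text that does not depend on the input, so that the number of variables in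
scope is bounded by a constant of the program. Each unit step is therefore carried out by `O(1)`
instructions of a real RAM, and a time bound `O(T)` in this model is a time bound `O(T)` on the
real RAM. -/

namespace RealProg

/-- Data. -/
inductive Val : Type
  | real (x : ℝ)
  | nil
  | pair (u v : Val)

/-- The arithmetic operations. -/
inductive Op : Type
  | add
  | sub
  | mul
  | div

/-- The result of an arithmetic operation; division by `0` is an error. -/
noncomputable def Op.apply : Op → ℝ → ℝ → Option ℝ
  | .add, x, y => some (x + y)
  | .sub, x, y => some (x - y)
  | .mul, x, y => some (x * y)
  | .div, x, y => if y = 0 then none else some (x / y)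

/-- Expressions. Variables are de Bruijn indices into the list of values in scope. -/
inductive Expr : Type
  /-- the variable of index `i` -/
  | var (i : ℕ)
  /-- a rational constant -/
  | const (q : ℚ)
  /-- an arithmetic operation on two reals -/
  | op (o : Op) (e₁ e₂ : Expr)
  /-- if the real `e₁` is at most the real `e₂` then `e₃` else `e₄` -/
  | ifLe (e₁ e₂ e₃ e₄ : Expr)
  /-- the empty list -/
  | nil
  /-- a new record with the two given fields -/
  | pair (e₁ e₂ : Expr)
  /-- case distinction on `e`: the value is that of `e₁` if `e` is the empty list, and that of
  `e₂`, with the two fields as new variables `0` and `1`, if `e` is a record -/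
  | cases (e e₁ e₂ : Expr)
  /-- local definition: the value of `e₁` becomes the new variable `0` in `e₂` -/
  | letIn (e₁ e₂ : Expr)
  /-- call of the function number `f` of the program with the argument `e` -/
  | call (f : ℕ) (e : Expr)

/-- `Eval fns env e v t`: in the program with the function bodies `fns`, and with the values
`env` of the variables in scope, the expression `e` evaluates to `v` in exactly `t` steps.
In the body of a function the variable `0` is its argument, and no other variable is in scope.
There is no rule for an erroneous or non-terminating evaluation. -/
inductive Eval (fns : List Expr) : List Val → Expr → Val → ℕ → Prop
  | var {env : List Val} {i : ℕ} {v : Val} (h : env[i]? = some v) :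
      Eval fns env (.var i) v 1
  | const {env : List Val} {q : ℚ} :
      Eval fns env (.const q) (.real (q : ℝ)) 1
  | op {env : List Val} {o : Op} {e₁ e₂ : Expr} {x y z : ℝ} {s t : ℕ}
      (h₁ : Eval fns env e₁ (.real x) s) (h₂ : Eval fns env e₂ (.real y) t)
      (h : o.apply x y = some z) :
      Eval fns env (.op o e₁ e₂) (.real z) (s + t + 1)
  | ifLe_true {env : List Val} {e₁ e₂ e₃ e₄ : Expr} {x y : ℝ} {v : Val} {r s t : ℕ}
      (h₁ : Eval fns env e₁ (.real x) r) (h₂ : Eval fns env e₂ (.real y) s)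
      (h : x ≤ y) (h₃ : Eval fns env e₃ v t) :
      Eval fns env (.ifLe e₁ e₂ e₃ e₄) v (r + s + t + 1)
  | ifLe_false {env : List Val} {e₁ e₂ e₃ e₄ : Expr} {x y : ℝ} {v : Val} {r s t : ℕ}
      (h₁ : Eval fns env e₁ (.real x) r) (h₂ : Eval fns env e₂ (.real y) s)
      (h : ¬ x ≤ y) (h₄ : Eval fns env e₄ v t) :
      Eval fns env (.ifLe e₁ e₂ e₃ e₄) v (r + s + t + 1)
  | nil {env : List Val} :
      Eval fns env .nil .nil 1
  | pair {env : List Val} {e₁ e₂ : Expr} {u v : Val} {s t : ℕ}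
      (h₁ : Eval fns env e₁ u s) (h₂ : Eval fns env e₂ v t) :
      Eval fns env (.pair e₁ e₂) (.pair u v) (s + t + 1)
  | cases_nil {env : List Val} {e e₁ e₂ : Expr} {v : Val} {s t : ℕ}
      (h : Eval fns env e .nil s) (h₁ : Eval fns env e₁ v t) :
      Eval fns env (.cases e e₁ e₂) v (s + t + 1)
  | cases_pair {env : List Val} {e e₁ e₂ : Expr} {a b v : Val} {s t : ℕ}
      (h : Eval fns env e (.pair a b) s) (h₂ : Eval fns (a :: b :: env) e₂ v t) :
      Eval fns env (.cases e e₁ e₂) v (s + t + 1)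
  | letIn {env : List Val} {e₁ e₂ : Expr} {u v : Val} {s t : ℕ}
      (h₁ : Eval fns env e₁ u s) (h₂ : Eval fns (u :: env) e₂ v t) :
      Eval fns env (.letIn e₁ e₂) v (s + t + 1)
  | call {env : List Val} {f : ℕ} {e body : Expr} {u v : Val} {s t : ℕ}
      (h₁ : Eval fns env e u s) (hf : fns[f]? = some body) (h₂ : Eval fns [u] body v t) :
      Eval fns env (.call f e) v (s + t + 1)

/-- Evaluation is deterministic: the value and the number of steps are unique. -/
theorem Eval.deterministic {fns : List Expr} {env : List Val} {e : Expr} {v v' : Val} {t t' : ℕ}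
    (h : Eval fns env e v t) (h' : Eval fns env e v' t') : v = v' ∧ t = t' := by
  induction h generalizing v' t' with
  | var h => cases h' with
    | var k => simp_all
  | const => cases h'; simp
  | op h₁ h₂ h ih₁ ih₂ => cases h' with
    | op k₁ k₂ k =>
      have a := ih₁ k₁
      have b := ih₂ k₂
      simp_all
  | ifLe_true h₁ h₂ h h₃ ih₁ ih₂ ih₃ => cases h' with
    | ifLe_true k₁ k₂ k k₃ =>
      have a := ih₁ k₁
      have b := ih₂ k₂
      have c := ih₃ k₃
      simp_all
    | ifLe_false k₁ k₂ k k₃ =>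
      have a := ih₁ k₁
      have b := ih₂ k₂
      simp only [Val.real.injEq] at a b
      exact absurd (a.1 ▸ b.1 ▸ h) k
  | ifLe_false h₁ h₂ h h₃ ih₁ ih₂ ih₃ => cases h' with
    | ifLe_true k₁ k₂ k k₃ =>
      have a := ih₁ k₁
      have b := ih₂ k₂
      simp only [Val.real.injEq] at a b
      exact absurd (a.1 ▸ b.1 ▸ k) h
    | ifLe_false k₁ k₂ k k₃ =>
      have a := ih₁ k₁
      have b := ih₂ k₂
      have c := ih₃ k₃
      simp_all
  | nil => cases h'; simp
  | pair h₁ h₂ ih₁ ih₂ => cases h' with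
    | pair k₁ k₂ =>
      have a := ih₁ k₁
      have b := ih₂ k₂
      simp_all
  | cases_nil h h₁ ih ih₁ => cases h' with
    | cases_nil k k₁ =>
      have a := ih k
      have b := ih₁ k₁
      simp_all
    | cases_pair k k₁ => simpa using (ih k).1
  | cases_pair h h₁ ih ih₁ => cases h' with
    | cases_nil k k₁ => simpa using (ih k).1
    | cases_pair k k₁ =>
      obtain ⟨a, rfl⟩ := ih k
      cases a
      have b := ih₁ k₁
      simp_all
  | letIn h₁ h₂ ih₁ ih₂ => cases h' with
    | letIn k₁ k₂ =>
      obtain ⟨rfl, rfl⟩ := ih₁ k₁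
      have b := ih₂ k₂
      simp_all
  | call h₁ hf h₂ ih₁ ih₂ => cases h' with
    | call k₁ kf k₂ =>
      obtain ⟨rfl, rfl⟩ := ih₁ k₁
      rw [hf] at kf
      cases kf
      have b := ih₂ k₂
      simp_all

/-- A program: finitely many function bodies and a main expression, whose variable `0` is the
input. -/
structure Program where
  fns : List Expr
  main : Expr

/-- On the input `x` the program `P` halts with the output `y` after exactly `t` steps. -/
def Program.Runs (P : Program) (x y : Val) (t : ℕ) : Prop :=
  Eval P.fns [x] P.main y t

/-- A point as input: its two coordinates. -/
def encodePoint (p : ℝ × ℝ) : Val :=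
  .pair (.real p.1) (.real p.2)

/-- A linked list of points as input. -/
def encodePoints : List (ℝ × ℝ) → Val
  | [] => .nil
  | p :: l => .pair (encodePoint p) (encodePoints l)

/-- A slab as output: its four coefficients. -/
def encodeSlab (σ : TwoLineCenter.Slab) : Val :=
  .pair (.pair (.real σ.a) (.real σ.b)) (.pair (.real σ.lo) (.real σ.hi))

/-- A pair of slabs as output. -/
def encodeSlabs (σ₁ σ₂ : TwoLineCenter.Slab) : Val :=
  .pair (encodeSlab σ₁) (encodeSlab σ₂)

end RealProg

namespace RealProg

/-! ### Call-free evaluation and running times -/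

/-! The constant 10 comes from one estimate, `lineDist_le_of_mem_slab`: if `u`, `v`, `z` lie in a
slab of width at most `w` and |uz| ≤ κ|uv|, then `z` is within (1 + κ)w of the line uv. Call `u`,
`v` an anchor pair if they lie in the same slab of a cover by two slabs of width at most `w` and
every input point is within 4|uv| of `u`. Then the slab of half-width 5w around the line uv contains
all input points of that slab, and its width is 10w.

Constantly many candidates suffice (`le_of_candidates`). Let `p` be an input point, `q` one farthest
from `p`, and split the input into the points `A` nearer to `p` (ties included) and `B` nearer to
`q`. Let `a` be farthest from `p` in `A` and `a'` farthest from the line pa; define `b`, `b'`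
likewise from `q` and `B`. If one of the pairs (p,q), (q,a), (q,a'), (p,b), (p,b') lies in a single
slab, it is an anchor pair. Otherwise `p`, `a`, `a'` share one slab and `q`, `b`, `b'` the other,
and the lines pa and qb are within 2w of `A` and `B`.

Given the line `L` of an anchor pair, the points farther than 5w from `L` lie in the other slab. Let
`o` be farthest from `L`; the line from `o` to the farthest of these points is within 2w of all of
them (`farCovered_of_anchor`). As w is unknown, the cut between the two lines is found by bisection
at medians of the distances to `L`, computed in linear time by medians of five. A probe must not
rescan the points already assigned to the second line: each accepted probe leaves only one
representative, its farthest point, and a running error. By `lineDist_lineThrough_le` the true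
squared error is at most four times the measured one, and this factor does not accumulate, because
every probe measures all representatives again. A probe is accepted if four times its error is at
most the squared distance at the cut; since 4(2w)² ≤ (5w)², no cut beyond 5w is rejected
(`SearchInv.accept`, `SearchInv.reject`).

A round costs O(n + |Q|) for n unassigned points and the list `Q` of representatives; n is at least
halved and |Q| grows by at most one, so the total is linear (`exists_evalLe_search`). All
comparisons are between squared distances, so no roots are needed. -/

/-- The value of an expression without calls. -/
noncomputable def run : List Val → Expr → Option Val
  | env, .var i => env[i]?
  | _, .const q => some (.real q)
  | env, .op o e₁ e₂ =>
    match run env e₁, run env e₂ with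
    | some (.real x), some (.real y) => (o.apply x y).map .real
    | _, _ => none
  | env, .ifLe e₁ e₂ e₃ e₄ =>
    match run env e₁, run env e₂ with
    | some (.real x), some (.real y) => if x ≤ y then run env e₃ else run env e₄
    | _, _ => none
  | _, .nil => some .nil
  | env, .pair e₁ e₂ =>
    match run env e₁, run env e₂ with
    | some u, some v => some (.pair u v)
    | _, _ => none
  | env, .cases e e₁ e₂ =>
    match run env e with
    | some .nil => run env e₁
    | some (.pair a b) => run (a :: b :: env) e₂
    | _ => none
  | env, .letIn e₁ e₂ =>
    match run env e₁ with
    | some u => run (u :: env) e₂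
    | none => none
  | _, .call _ _ => none

/-- A bound for the number of steps of an expression without calls. -/
def cost : Expr → ℕ
  | .var _ | .const _ | .nil => 1
  | .op _ e₁ e₂ | .pair e₁ e₂ | .letIn e₁ e₂ => cost e₁ + cost e₂ + 1
  | .ifLe e₁ e₂ e₃ e₄ => cost e₁ + cost e₂ + (cost e₃ + cost e₄) + 1
  | .cases e e₁ e₂ => cost e + (cost e₁ + cost e₂) + 1
  | .call _ e => cost e

/-- The expression evaluates to `v` in at most `B` steps. -/
def EvalLe (fns : List Expr) (env : List Val) (e : Expr) (v : Val) (B : ℕ) : Prop :=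
  ∃ t ≤ B, Eval fns env e v t

variable {fns : List Expr} {env : List Val} {e e₁ e₂ e₃ e₄ : Expr} {u v w : Val} {B B₁ B₂ : ℕ}

theorem EvalLe.mono (h : EvalLe fns env e v B₁) (hB : B₁ ≤ B₂) : EvalLe fns env e v B₂ :=
  h.imp fun _ ht => ⟨ht.1.trans hB, ht.2⟩

/-- `cost` adds up both branches of every test, so the bound does not depend on data. The
constant-time pieces of the program thus reduce to `rfl` or `simp` for the value and `decide` for
the time. -/
theorem EvalLe.of_run (h : run env e = some v) : EvalLe fns env e v (cost e) := by
  induction e generalizing env v with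
  | var i => exact ⟨1, le_rfl, .var h⟩
  | const q =>
    cases h
    exact ⟨1, le_rfl, .const⟩
  | op o e₁ e₂ ih₁ ih₂ =>
    simp only [run] at h
    split at h
    · rename_i x y hx hy
      obtain ⟨z, hz, rfl⟩ := Option.map_eq_some_iff.1 h
      obtain ⟨s, hs, h₁⟩ := ih₁ hx
      obtain ⟨t, ht, h₂⟩ := ih₂ hy
      exact ⟨_, by simp only [cost]; omega, .op h₁ h₂ hz⟩
    · cases h
  | ifLe e₁ e₂ e₃ e₄ ih₁ ih₂ ih₃ ih₄ =>
    simp only [run] at h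
    split at h
    · rename_i x y hx hy
      obtain ⟨s, hs, h₁⟩ := ih₁ hx
      obtain ⟨t, ht, h₂⟩ := ih₂ hy
      split at h
      · obtain ⟨r, hr, h₃⟩ := ih₃ h
        exact ⟨_, by simp only [cost]; omega, .ifLe_true h₁ h₂ ‹_› h₃⟩
      · obtain ⟨r, hr, h₃⟩ := ih₄ h
        exact ⟨_, by simp only [cost]; omega, .ifLe_false h₁ h₂ ‹_› h₃⟩
    · cases h
  | nil =>
    cases h
    exact ⟨1, le_rfl, .nil⟩
  | pair e₁ e₂ ih₁ ih₂ =>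
    simp only [run] at h
    split at h
    · rename_i x y hx hy
      cases h
      obtain ⟨s, hs, h₁⟩ := ih₁ hx
      obtain ⟨t, ht, h₂⟩ := ih₂ hy
      exact ⟨_, by simp only [cost]; omega, .pair h₁ h₂⟩
    · cases h
  | cases e e₁ e₂ ih ih₁ ih₂ =>
    simp only [run] at h
    split at h
    · rename_i hx
      obtain ⟨s, hs, h₁⟩ := ih hx
      obtain ⟨t, ht, h₂⟩ := ih₁ h
      exact ⟨_, by simp only [cost]; omega, .cases_nil h₁ h₂⟩
    · rename_i hx
      obtain ⟨s, hs, h₁⟩ := ih hx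
      obtain ⟨t, ht, h₂⟩ := ih₂ h
      exact ⟨_, by simp only [cost]; omega, .cases_pair h₁ h₂⟩
    · cases h
  | letIn e₁ e₂ ih₁ ih₂ =>
    simp only [run] at h
    split at h
    · rename_i hx
      obtain ⟨s, hs, h₁⟩ := ih₁ hx
      obtain ⟨t, ht, h₂⟩ := ih₂ h
      exact ⟨_, by simp only [cost]; omega, .letIn h₁ h₂⟩
    · cases h
  | call f e ih => cases h

theorem EvalLe.of_run_le (c : ℕ) (hc : cost e ≤ c) (h : run env e = some v) :
    EvalLe fns env e v c :=
  (EvalLe.of_run h).mono hc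

theorem EvalLe.letIn (h₁ : EvalLe fns env e₁ u B₁) (h₂ : EvalLe fns (u :: env) e₂ v B₂) :
    EvalLe fns env (.letIn e₁ e₂) v (B₁ + B₂ + 1) := by
  obtain ⟨s, hs, h₁⟩ := h₁
  obtain ⟨t, ht, h₂⟩ := h₂
  exact ⟨_, by omega, .letIn h₁ h₂⟩

theorem EvalLe.pair (h₁ : EvalLe fns env e₁ u B₁) (h₂ : EvalLe fns env e₂ v B₂) :
    EvalLe fns env (.pair e₁ e₂) (.pair u v) (B₁ + B₂ + 1) := by
  obtain ⟨s, hs, h₁⟩ := h₁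
  obtain ⟨t, ht, h₂⟩ := h₂
  exact ⟨_, by omega, .pair h₁ h₂⟩

theorem EvalLe.cases_nil (c : ℕ) (hc : cost e < c) (h : run env e = some .nil)
    (h₁ : EvalLe fns env e₁ v B) :
    EvalLe fns env (.cases e e₁ e₂) v (c + B) := by
  obtain ⟨s, hs, h⟩ := EvalLe.of_run (fns := fns) h
  obtain ⟨t, ht, h₁⟩ := h₁
  exact ⟨_, by omega, .cases_nil h h₁⟩

theorem EvalLe.cases_pair (c : ℕ) (hc : cost e < c) {a b : Val} (h : run env e = some (.pair a b))
    (h₂ : EvalLe fns (a :: b :: env) e₂ v B) :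
    EvalLe fns env (.cases e e₁ e₂) v (c + B) := by
  obtain ⟨s, hs, h⟩ := EvalLe.of_run (fns := fns) h
  obtain ⟨t, ht, h₂⟩ := h₂
  exact ⟨_, by omega, .cases_pair h h₂⟩

theorem EvalLe.ifLe (c : ℕ) (hc : cost e₁ + cost e₂ < c) {x y : ℝ}
    (h₁ : run env e₁ = some (.real x)) (h₂ : run env e₂ = some (.real y))
    (h₃ : x ≤ y → EvalLe fns env e₃ v B) (h₄ : ¬ x ≤ y → EvalLe fns env e₄ v B) :
    EvalLe fns env (.ifLe e₁ e₂ e₃ e₄) v (c + B) := by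
  obtain ⟨s, hs, h₁⟩ := EvalLe.of_run (fns := fns) h₁
  obtain ⟨t, ht, h₂⟩ := EvalLe.of_run (fns := fns) h₂
  by_cases h : x ≤ y
  · obtain ⟨r, hr, h₃⟩ := h₃ h
    exact ⟨_, by omega, .ifLe_true h₁ h₂ h h₃⟩
  · obtain ⟨r, hr, h₄⟩ := h₄ h
    exact ⟨_, by omega, .ifLe_false h₁ h₂ h h₄⟩

theorem EvalLe.call (c : ℕ) (hc : cost e < c) {f : ℕ} {body : Expr}
    (h₁ : run env e = some u) (hf : fns[f]? = some body)
    (h₂ : EvalLe fns [u] body v B) : EvalLe fns env (.call f e) v (c + B) := by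
  obtain ⟨s, hs, h₁⟩ := EvalLe.of_run (fns := fns) h₁
  obtain ⟨t, ht, h₂⟩ := h₂
  exact ⟨_, by omega, .call h₁ hf h₂⟩

/-! ### Lists and loops -/

/-- A linked list. -/
def encodeList {α : Type*} (ex : α → Val) : List α → Val
  | [] => .nil
  | a :: l => .pair (ex a) (encodeList ex l)

theorem encodePoints_eq (l : List (ℝ × ℝ)) : encodePoints l = encodeList encodePoint l := by
  induction l with
  | nil => rfl
  | cons p l ih => simp [encodePoints, encodeList, ih]

/-- First field of a record. -/
def fstE (e : Expr) : Expr := .cases e .nil (.var 0)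

/-- Second field of a record. -/
def sndE (e : Expr) : Expr := .cases e .nil (.var 1)

theorem run_fstE {a b : Val} (h : run env e = some (.pair a b)) : run env (fstE e) = some a := by
  simp [fstE, run, h]

/-- The body of a loop over a list: the argument is the accumulator and the list; in `step`, the
variable `0` is the current element and the variable `2` is the accumulator. -/
def foldBody (f : ℕ) (step : Expr) : Expr :=
  .cases (.var 0) .nil (.cases (.var 1) (.var 0) (.call f (.pair step (.var 1))))

/-- The entries `r₁`, `r₂`, `r₃` are what the two case distinctions leave in scope: the tail, the
list and the argument. A step may not depend on them. -/
theorem EvalLe.foldBody {α β : Type*} {f : ℕ} {step : Expr} (ex : α → Val) (ea : β → Val)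
    (s : β → α → β) (hf : fns[f]? = some (foldBody f step))
    (hs : ∀ b a r₁ r₂ r₃, run [ex a, r₁, ea b, r₂, r₃] step = some (ea (s b a)))
    (l : List α) (b : β) :
    EvalLe fns [.pair (ea b) (encodeList ex l)] (foldBody f step) (ea (l.foldl s b))
      ((cost step + 8) * (l.length + 1)) := by
  induction l generalizing b with
  | nil =>
    refine (EvalLe.cases_pair 2 (by decide) (a := ea b) (b := .nil) rfl
      (EvalLe.cases_nil 2 (by decide) rfl (.of_run (v := ea b) rfl))).mono ?_
    simp only [cost, List.length_nil]
    omega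
  | cons a l ih =>
    refine (EvalLe.cases_pair 2 (by decide) (a := ea b) (b := encodeList ex (a :: l)) rfl
      (EvalLe.cases_pair 2 (by decide) (a := ex a) (b := encodeList ex l) rfl
        (EvalLe.call (cost step + 3) (by simp only [cost]; omega)
          (u := .pair (ea (s b a)) (encodeList ex l)) ?_ hf (ih (s b a))))).mono ?_
    · simp [run, hs]
    · simp only [List.length_cons]
      ring_nf
      omega

/-- A loop, called with an initial accumulator and a list. -/
theorem EvalLe.call_fold (c : ℕ) {α β : Type*} {f : ℕ} {step : Expr} (ex : α → Val) (ea : β → Val)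
    (s : β → α → β) (hc : cost e + cost step + 9 ≤ c)
    (hf : fns[f]? = some (RealProg.foldBody f step))
    (hs : ∀ b a r₁ r₂ r₃, run [ex a, r₁, ea b, r₂, r₃] step = some (ea (s b a)))
    {l : List α} {b : β} (h : run env e = some (.pair (ea b) (encodeList ex l))) {n : ℕ}
    (hn : l.length ≤ n) :
    EvalLe fns env (.call f e) (ea (l.foldl s b)) (c * (n + 1)) := by
  refine (EvalLe.call (cost e + 1) (by omega) h hf (EvalLe.foldBody ex ea s hf hs l b)).mono ?_
  have : (cost step + 8) * (l.length + 1) ≤ (cost step + 8) * (n + 1) := by gcongr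
  nlinarith [Nat.mul_le_mul_right (n + 1) hc]

/-- Loop step that collects the elements with `e₁ ≤ e₂`; the accumulator is a record of parameters
and the list of the elements found. -/
def keepStep (e₁ e₂ : Expr) : Expr :=
  .ifLe e₁ e₂ (.pair (fstE (.var 2)) (.pair (.var 0) (sndE (.var 2)))) (.var 2)

/-- Loop step that collects the elements with `e₁ > e₂`. -/
def dropStep (e₁ e₂ : Expr) : Expr :=
  .ifLe e₁ e₂ (.var 2) (.pair (fstE (.var 2)) (.pair (.var 0) (sndE (.var 2))))

theorem foldl_ite_cons {α : Type*} (p : α → Prop) [DecidablePred p] (l out : List α) :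
    l.foldl (fun o a => if p a then a :: o else o) out = (l.filter p).reverse ++ out := by
  induction l generalizing out with
  | nil => rfl
  | cons a l ih =>
    by_cases h : p a <;> simp [ih, h]

theorem EvalLe.call_keep (c : ℕ) {α : Type*} {f : ℕ} (ex : α → Val) (x y : α → ℝ) (P : Val)
    (hc : cost e + cost (keepStep e₁ e₂) + 9 ≤ c)
    (hf : fns[f]? = some (RealProg.foldBody f (keepStep e₁ e₂)))
    (hx : ∀ a o r₁ r₂ r₃, run [ex a, r₁, .pair P o, r₂, r₃] e₁ = some (.real (x a)))
    (hy : ∀ a o r₁ r₂ r₃, run [ex a, r₁, .pair P o, r₂, r₃] e₂ = some (.real (y a)))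
    {l out : List α} (h : run env e = some (.pair (.pair P (encodeList ex out)) (encodeList ex l)))
    {n : ℕ} (hn : l.length ≤ n) :
    EvalLe fns env (.call f e)
      (.pair P (encodeList ex ((l.filter fun a => x a ≤ y a).reverse ++ out)))
      (c * (n + 1)) := by
  rw [← foldl_ite_cons]
  refine EvalLe.call_fold c ex (fun o => .pair P (encodeList ex o)) _ hc hf ?_ h hn
  intro o a r₁ r₂ r₃
  simp only [keepStep, run, hx, hy, fstE, sndE]
  split_ifs <;> simp [encodeList]

theorem EvalLe.call_drop (c : ℕ) {α : Type*} {f : ℕ} (ex : α → Val) (x y : α → ℝ) (P : Val)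
    (hc : cost e + cost (dropStep e₁ e₂) + 9 ≤ c)
    (hf : fns[f]? = some (RealProg.foldBody f (dropStep e₁ e₂)))
    (hx : ∀ a o r₁ r₂ r₃, run [ex a, r₁, .pair P o, r₂, r₃] e₁ = some (.real (x a)))
    (hy : ∀ a o r₁ r₂ r₃, run [ex a, r₁, .pair P o, r₂, r₃] e₂ = some (.real (y a)))
    {l out : List α} (h : run env e = some (.pair (.pair P (encodeList ex out)) (encodeList ex l)))
    {n : ℕ} (hn : l.length ≤ n) :
    EvalLe fns env (.call f e)
      (.pair P (encodeList ex ((l.filter fun a => y a < x a).reverse ++ out)))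
      (c * (n + 1)) := by
  rw [← foldl_ite_cons]
  refine EvalLe.call_fold c ex (fun o => .pair P (encodeList ex o)) _ hc hf ?_ h hn
  intro o a r₁ r₂ r₃
  simp only [dropStep, run, hx, hy, fstE, sndE, ← not_le]
  split_ifs <;> simp [encodeList]

/-- Loop step that finds an element with the greatest key; the accumulator is a record of
parameters and of the pair of the greatest key so far and its element. -/
def argmaxStep (key : Expr) : Expr :=
  .letIn key (.ifLe (.var 0) (fstE (sndE (.var 3))) (.var 3)
    (.pair (fstE (.var 3)) (.pair (.var 0) (.var 1))))

/-- The loop `argmaxStep` as a function. -/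
noncomputable def argmax {α : Type*} (k : α → ℝ) (l : List α) (i : α) : α :=
  l.foldl (fun b a => if k a ≤ k b then b else a) i

theorem le_argmax {α : Type*} (k : α → ℝ) (l : List α) (i : α) :
    k i ≤ k (argmax k l i) ∧ ∀ a ∈ l, k a ≤ k (argmax k l i) := by
  induction l generalizing i with
  | nil => simp [argmax]
  | cons a l ih =>
    obtain ⟨h₁, h₂⟩ := ih (if k a ≤ k i then i else a)
    change k _ ≤ k (argmax k (a :: l) i) at h₁
    refine ⟨?_, fun b hb => ?_⟩
    · refine le_trans ?_ h₁
      split_ifs with h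
      · exact le_rfl
      · exact (not_le.1 h).le
    · rcases List.mem_cons.1 hb with rfl | hb
      · refine le_trans ?_ h₁
        split_ifs with h
        · exact h
        · exact le_rfl
      · exact h₂ b hb

theorem argmax_mem {α : Type*} (k : α → ℝ) (l : List α) (i : α) :
    argmax k l i = i ∨ argmax k l i ∈ l := by
  induction l generalizing i with
  | nil => simp [argmax]
  | cons a l ih =>
    have := ih (if k a ≤ k i then i else a)
    change argmax k (a :: l) i = _ ∨ argmax k (a :: l) i ∈ l at this
    split_ifs at this <;> simp only [List.mem_cons] <;> tauto

theorem EvalLe.call_argmax (c : ℕ) {α : Type*} {f : ℕ} {key : Expr} (ex : α → Val) (k : α → ℝ)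
    (P : Val)
    (hc : cost e + cost (argmaxStep key) + 9 ≤ c)
    (hf : fns[f]? = some (RealProg.foldBody f (argmaxStep key)))
    (hk : ∀ a o r₁ r₂ r₃, run [ex a, r₁, .pair P o, r₂, r₃] key = some (.real (k a)))
    {l : List α} {i : α}
    (h : run env e = some (.pair (.pair P (.pair (.real (k i)) (ex i))) (encodeList ex l)))
    {n : ℕ} (hn : l.length ≤ n) :
    EvalLe fns env (.call f e)
      (.pair P (.pair (.real (k (argmax k l i))) (ex (argmax k l i))))
      (c * (n + 1)) := by
  refine EvalLe.call_fold c ex (fun b => .pair P (.pair (.real (k b)) (ex b))) _ hc hf ?_ h hn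
  intro o a r₁ r₂ r₃
  simp only [argmaxStep, run, hk, fstE, sndE, List.getElem?_cons_zero, List.getElem?_cons_succ]
  split_ifs <;> rfl

/-- Loop step that counts. -/
def countStep : Expr := .op .add (.var 2) (.const 1)

theorem EvalLe.call_count (c : ℕ) {α : Type*} {f : ℕ} (ex : α → Val)
    (hc : cost e + cost countStep + 9 ≤ c)
    (hf : fns[f]? = some (RealProg.foldBody f countStep)) {l : List α}
    (h : run env e = some (.pair (.real 0) (encodeList ex l))) {n : ℕ} (hn : l.length ≤ n) :
    EvalLe fns env (.call f e) (.real l.length) (c * (n + 1)) := by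
  have := EvalLe.call_fold (fns := fns) (env := env) (e := e) (l := l) (b := (0 : ℝ)) c ex
    Val.real (fun b _ => b + 1) hc hf ?_ h hn
  · suffices H : ∀ b : ℝ, l.foldl (fun b _ => b + 1) b = b + l.length by
      simpa [H] using this
    clear this h hn
    induction l with
    | nil => simp
    | cons a l ih =>
      intro b
      simp [ih]
      ring
  · intro b a r₁ r₂ r₃
    simp [countStep, run, Op.apply]

/-- Loop step that collects the values of `e`; the accumulator is a record of parameters and the
list of values. -/
def mapStep (e : Expr) : Expr := .pair (fstE (.var 2)) (.pair e (sndE (.var 2)))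

theorem EvalLe.call_map (c : ℕ) {α : Type*} {f : ℕ} {key : Expr} (ex : α → Val) (k : α → ℝ)
    (P : Val)
    (hc : cost e + cost (mapStep key) + 9 ≤ c)
    (hf : fns[f]? = some (RealProg.foldBody f (mapStep key)))
    (hk : ∀ a o r₁ r₂ r₃, run [ex a, r₁, .pair P o, r₂, r₃] key = some (.real (k a)))
    {l : List α} (h : run env e = some (.pair (.pair P .nil) (encodeList ex l)))
    {n : ℕ} (hn : l.length ≤ n) :
    EvalLe fns env (.call f e) (.pair P (encodeList .real (l.map k).reverse))
      (c * (n + 1)) := by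
  have := EvalLe.call_fold (fns := fns) (env := env) (e := e) (l := l) (b := ([] : List ℝ)) c
    ex (fun o => .pair P (encodeList .real o)) (fun b a => k a :: b) hc hf ?_ h hn
  · simpa [List.foldl_flip_cons_eq_append] using this
  · intro b a r₁ r₂ r₃
    simp [mapStep, run, hk, fstE, sndE, encodeList]

end RealProg

/-! ### Squared distances and lines as used by the program -/

namespace TwoLineCenter

/-- Squared distance. -/
def sqDist (p q : ℝ × ℝ) : ℝ :=
  (q.1 - p.1) * (q.1 - p.1) + (q.2 - p.2) * (q.2 - p.2)

/-- Squared length of the direction of a line, given by a point and a direction. -/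
def sqLen (L : (ℝ × ℝ) × (ℝ × ℝ)) : ℝ := L.2.1 * L.2.1 + L.2.2 * L.2.2

/-- Signed distance to a line, multiplied by the length of its direction. -/
def cross (L : (ℝ × ℝ) × (ℝ × ℝ)) (z : ℝ × ℝ) : ℝ :=
  L.2.1 * (z.2 - L.1.2) - L.2.2 * (z.1 - L.1.1)

/-- The square of `cross`. -/
def sqCross (L : (ℝ × ℝ) × (ℝ × ℝ)) (z : ℝ × ℝ) : ℝ := cross L z * cross L z

open Classical in
/-- The line through two points (the horizontal line if they coincide). -/
noncomputable def lineThrough (p q : ℝ × ℝ) : (ℝ × ℝ) × (ℝ × ℝ) :=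
  (p, if sqDist p q ≤ 0 then (1, 0) else (q.1 - p.1, q.2 - p.2))

end TwoLineCenter

namespace RealProg

open TwoLineCenter

/-- A line: a point and a direction. -/
def encodeLine (L : (ℝ × ℝ) × (ℝ × ℝ)) : Val := .pair (encodePoint L.1) (encodePoint L.2)

/-! ### The program -/

def sqDistE (p q : Expr) : Expr :=
  .op .add (.op .mul (.op .sub (fstE q) (fstE p)) (.op .sub (fstE q) (fstE p)))
    (.op .mul (.op .sub (sndE q) (sndE p)) (.op .sub (sndE q) (sndE p)))

def sqLenE (L : Expr) : Expr :=
  .op .add (.op .mul (fstE (sndE L)) (fstE (sndE L))) (.op .mul (sndE (sndE L)) (sndE (sndE L)))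

def crossE (L z : Expr) : Expr :=
  .op .sub (.op .mul (fstE (sndE L)) (.op .sub (sndE z) (sndE (fstE L))))
    (.op .mul (sndE (sndE L)) (.op .sub (fstE z) (fstE (fstE L))))

def sqCrossE (L z : Expr) : Expr := .op .mul (crossE L z) (crossE L z)

def lineThroughE (p q : Expr) : Expr :=
  .pair p (.ifLe (sqDistE p q) (.const 0) (.pair (.const 1) (.const 0))
    (.pair (.op .sub (fstE q) (fstE p)) (.op .sub (sndE q) (sndE p))))

def maxE (a b : Expr) : Expr := .ifLe a b b a

def minE (a b : Expr) : Expr := .ifLe a b a b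

/-- Medians of groups of five consecutive elements. -/
def mediansBody : Expr :=
  .cases (.var 0) .nil (.cases (.var 1) .nil (.cases (.var 1) .nil (.cases (.var 1) .nil
    (.cases (.var 1) .nil
      (.pair
        (.letIn (maxE (minE (.var 0) (.var 2)) (minE (.var 4) (.var 6)))
          (.letIn (minE (maxE (.var 1) (.var 3)) (maxE (.var 5) (.var 7)))
            (maxE (minE (.var 10) (.var 0)) (minE (maxE (.var 10) (.var 0)) (.var 1)))))
        (.call 3 (.var 1)))))))

/-- Selection by rank; the argument is the rank and the list. -/
def selectBody : Expr :=
  .letIn (.call 3 (sndE (.var 0))) <|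
  .letIn (.call 2 (.pair (.const 0) (.var 0))) <|
  .letIn (.cases (.var 1) (fstE (sndE (.var 2)))
    (.call 4 (.pair (.op .mul (.const (1 / 2)) (.var 2)) (.var 3)))) <|
  .letIn (sndE (.call 0 (.pair (.pair (.var 0) .nil) (sndE (.var 3))))) <|
  .letIn (sndE (.call 1 (.pair (.pair (.var 1) .nil) (sndE (.var 4))))) <|
  .letIn (.call 2 (.pair (.const 0) (.var 1))) <|
  .letIn (.call 2 (.pair (.const 0) (.var 1))) <|
  .letIn (.call 2 (.pair (.const 0) (sndE (.var 7)))) <|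
  .ifLe (fstE (.var 8)) (.var 2) (.call 4 (.pair (fstE (.var 8)) (.var 4))) <|
  .ifLe (fstE (.var 8)) (.op .sub (.var 0) (.var 1)) (.var 5) <|
  .call 4 (.pair (.op .sub (fstE (.var 8)) (.op .sub (.var 0) (.var 1))) (.var 3))

/-- Median of the keys; the argument is a line and a list of points. -/
def medianBody : Expr :=
  .letIn (sndE (.call 9 (.pair (.pair (fstE (.var 0)) .nil) (sndE (.var 0))))) <|
  .letIn (.call 2 (.pair (.const 0) (.var 0))) <|
  .call 4 (.pair (.op .mul (.const (1 / 2)) (.var 0)) (.var 1))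

/-- The farthest point and the error of the line through it for the points with key at least the
threshold; the argument is `(((line, threshold), base), ((points, old points), old error))`. -/
def probeBody : Expr :=
  .letIn (sndE (.call 10 (.pair (.pair (fstE (fstE (.var 0))) (sndE (fstE (sndE (.var 0)))))
    (fstE (fstE (sndE (.var 0))))))) <|
  .letIn (sndE (sndE (.call 5 (.pair (.pair (sndE (fstE (.var 1)))
    (.pair (.const 0) (sndE (fstE (.var 1))))) (.var 0))))) <|
  .letIn (lineThroughE (sndE (fstE (.var 2))) (.var 0)) <|
  .letIn (fstE (sndE (.call 6 (.pair (.pair (.var 0)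
    (.pair (.const 0) (sndE (fstE (.var 3))))) (.var 2))))) <|
  .pair (.var 2) (maxE (sndE (sndE (.var 4))) (.op .div (.var 0) (sqLenE (.var 1))))

/-- Search for the threshold; the argument is
`((line, base), (points, (old points, (old error, old farthest point))))`. -/
def searchBody : Expr :=
  .cases (fstE (sndE (.var 0))) (sndE (sndE (sndE (sndE (.var 0))))) <|
  .letIn (.call 15 (.pair (fstE (fstE (.var 2))) (fstE (sndE (.var 2))))) <|
  .letIn (.call 16 (.pair (.pair (.pair (fstE (fstE (.var 3))) (.var 0)) (sndE (fstE (.var 3))))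
    (.pair (.pair (fstE (sndE (.var 3))) (fstE (sndE (sndE (.var 3)))))
      (fstE (sndE (sndE (sndE (.var 3)))))))) <|
  .ifLe (.op .mul (.op .mul (.const 4) (sndE (.var 0))) (sqLenE (fstE (fstE (.var 4))))) (.var 1)
    (.letIn (sndE (.call 11 (.pair (.pair (.pair (fstE (fstE (.var 4))) (.var 1)) .nil)
        (fstE (sndE (.var 4)))))) <|
      .call 14 (.pair (fstE (.var 5)) (.pair (.var 0)
        (.pair (.pair (fstE (.var 1)) (fstE (sndE (sndE (.var 5)))))
          (.pair (sndE (.var 1)) (fstE (.var 1)))))))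
    (.letIn (sndE (.call 12 (.pair (.pair (.pair (fstE (fstE (.var 4))) (.var 1)) .nil)
        (fstE (sndE (.var 4)))))) <|
      .call 14 (.pair (fstE (.var 5)) (.pair (.var 0) (sndE (sndE (.var 5))))))

/-- Loop step: each point is assigned to the nearer one of two lines. -/
def assignStep : Expr :=
  .letIn (maxE (crossE (fstE (fstE (.var 2))) (.var 0))
    (.op .sub (.const 0) (crossE (fstE (fstE (.var 2))) (.var 0)))) <|
  .letIn (maxE (crossE (sndE (fstE (.var 3))) (.var 1))
    (.op .sub (.const 0) (crossE (sndE (fstE (.var 3))) (.var 1)))) <|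
  .ifLe (.op .mul (.op .mul (.var 1) (.var 1)) (sqLenE (sndE (fstE (.var 4)))))
    (.op .mul (.op .mul (.var 0) (.var 0)) (sqLenE (fstE (fstE (.var 4)))))
    (.pair (fstE (.var 4)) (.pair (maxE (fstE (sndE (.var 4))) (.var 1)) (sndE (sndE (.var 4)))))
    (.pair (fstE (.var 4)) (.pair (fstE (sndE (.var 4))) (maxE (sndE (sndE (.var 4))) (.var 0))))

/-- The slab around the line `L` of half-width `k`, up to normalisation. -/
def slabE (L k : Expr) : Expr :=
  .pair (.pair (.op .sub (.const 0) (sndE (sndE L))) (fstE (sndE L)))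
    (.pair
      (.op .sub (.op .sub (.op .mul (fstE (sndE L)) (sndE (fstE L)))
        (.op .mul (sndE (sndE L)) (fstE (fstE L)))) k)
      (.op .add (.op .sub (.op .mul (fstE (sndE L)) (sndE (fstE L)))
        (.op .mul (sndE (sndE L)) (fstE (fstE L)))) k))

/-- The slabs around two lines that cover the points, after the square of the greater half-width;
the argument is the pair of lines and the list of points. -/
def slabsBody : Expr :=
  .letIn (sndE (.call 13 (.pair (.pair (fstE (.var 0)) (.pair (.const 0) (.const 0)))
    (sndE (.var 0))))) <|
  .pair
    (maxE (.op .div (.op .mul (fstE (.var 0)) (fstE (.var 0))) (sqLenE (fstE (fstE (.var 1)))))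
      (.op .div (.op .mul (sndE (.var 0)) (sndE (.var 0))) (sqLenE (sndE (fstE (.var 1))))))
    (.pair (slabE (fstE (fstE (.var 1))) (fstE (.var 0)))
      (slabE (sndE (fstE (.var 1))) (sndE (.var 0))))

/-- Slabs, the first of which is around the line through two given points; the argument is the pair
of points and the list of points. -/
def anchorBody : Expr :=
  .letIn (lineThroughE (fstE (fstE (.var 0))) (sndE (fstE (.var 0)))) <|
  .letIn (sndE (sndE (.call 6 (.pair (.pair (.var 0)
    (.pair (.const 0) (fstE (fstE (.var 1))))) (sndE (.var 1)))))) <|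
  .letIn (.call 14 (.pair (.pair (.var 1) (.var 0))
    (.pair (sndE (.var 2)) (.pair .nil (.pair (.const 0) (.var 0)))))) <|
  .call 17 (.pair (.pair (.var 2) (lineThroughE (.var 1) (.var 0))) (sndE (.var 3)))

/-- A line through the base and a farthest point, and that point and a point farthest from the line;
the argument is the base and the list of points. -/
def clusterBody : Expr :=
  .letIn (sndE (sndE (.call 5 (.pair (.pair (fstE (.var 0))
    (.pair (.const 0) (fstE (.var 0)))) (sndE (.var 0)))))) <|
  .letIn (lineThroughE (fstE (.var 1)) (.var 0)) <|
  .letIn (sndE (sndE (.call 6 (.pair (.pair (.var 0)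
    (.pair (.const 0) (fstE (.var 2)))) (sndE (.var 2)))))) <|
  .pair (.var 1) (.pair (.var 2) (.var 0))

/-- The better of a given solution and the one for an anchor; the argument is the solution and the
argument of `anchorBody`. -/
def improveBody : Expr :=
  .letIn (.call 18 (sndE (.var 0))) <|
  .ifLe (fstE (fstE (.var 1))) (fstE (.var 0)) (fstE (.var 1)) (.var 0)

/-- The functions of the program. -/
def twoLineFns : List Expr :=
  [foldBody 0 (dropStep (fstE (.var 2)) (.var 0)),
   foldBody 1 (dropStep (.var 0) (fstE (.var 2))),
   foldBody 2 countStep,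
   mediansBody,
   selectBody,
   foldBody 5 (argmaxStep (sqDistE (fstE (.var 2)) (.var 0))),
   foldBody 6 (argmaxStep (sqCrossE (fstE (.var 2)) (.var 0))),
   foldBody 7 (keepStep (sqDistE (fstE (fstE (.var 2))) (.var 0))
     (sqDistE (sndE (fstE (.var 2))) (.var 0))),
   foldBody 8 (dropStep (sqDistE (fstE (fstE (.var 2))) (.var 0))
     (sqDistE (sndE (fstE (.var 2))) (.var 0))),
   foldBody 9 (mapStep (sqCrossE (fstE (.var 2)) (.var 0))),
   foldBody 10 (keepStep (sndE (fstE (.var 2))) (sqCrossE (fstE (fstE (.var 2))) (.var 0))),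
   foldBody 11 (dropStep (sndE (fstE (.var 2))) (sqCrossE (fstE (fstE (.var 2))) (.var 0))),
   foldBody 12 (dropStep (sqCrossE (fstE (fstE (.var 2))) (.var 0)) (sndE (fstE (.var 2)))),
   foldBody 13 assignStep,
   searchBody,
   medianBody,
   probeBody,
   slabsBody,
   anchorBody,
   clusterBody,
   improveBody]

/-- The main expression of the program. -/
def twoLineMain : Expr :=
  .letIn (fstE (.var 0)) <|
  .letIn (sndE (sndE (.call 5 (.pair (.pair (.var 0) (.pair (.const 0) (.var 0))) (.var 1))))) <|
  .letIn (sndE (.call 7 (.pair (.pair (.pair (.var 1) (.var 0)) .nil) (.var 2)))) <|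
  .letIn (sndE (.call 8 (.pair (.pair (.pair (.var 2) (.var 1)) .nil) (.var 3)))) <|
  .letIn (.call 19 (.pair (.var 3) (.var 1))) <|
  .letIn (.call 19 (.pair (.var 3) (.var 1))) <|
  .letIn (.call 17 (.pair (.pair (fstE (.var 1)) (fstE (.var 0))) (.var 6))) <|
  .letIn (.call 20 (.pair (.var 0) (.pair (.pair (.var 6) (.var 5)) (.var 7)))) <|
  .letIn (.call 20 (.pair (.var 0) (.pair (.pair (.var 6) (fstE (sndE (.var 3)))) (.var 8)))) <|
  .letIn (.call 20 (.pair (.var 0) (.pair (.pair (.var 7) (sndE (sndE (.var 4)))) (.var 9)))) <|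
  .letIn (.call 20 (.pair (.var 0) (.pair (.pair (.var 9) (fstE (sndE (.var 4)))) (.var 10)))) <|
  .letIn (.call 20 (.pair (.var 0) (.pair (.pair (.var 10) (sndE (sndE (.var 5)))) (.var 11)))) <|
  sndE (.var 0)

/-! ### Evaluation of the basic expressions -/

variable {fns : List Expr} {env : List Val} {P Q e : Expr} {p q : ℝ × ℝ}
  {L : (ℝ × ℝ) × (ℝ × ℝ)}

theorem EvalLe.sndE {a b : Val} {B : ℕ} (h : EvalLe fns env e (.pair a b) B) :
    EvalLe fns env (sndE e) b (B + 2) := by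
  obtain ⟨t, ht, h⟩ := h
  exact ⟨_, by omega, .cases_pair h (.var rfl)⟩

theorem EvalLe.fstE {a b : Val} {B : ℕ} (h : EvalLe fns env e (.pair a b) B) :
    EvalLe fns env (fstE e) a (B + 2) := by
  obtain ⟨t, ht, h⟩ := h
  exact ⟨_, by omega, .cases_pair h (.var rfl)⟩

theorem run_sqDistE (hP : run env P = some (encodePoint p)) (hQ : run env Q = some (encodePoint q)) :
    run env (sqDistE P Q) = some (.real (sqDist p q)) := by
  simp [sqDistE, sqDist, run, fstE, sndE, hP, hQ, encodePoint, Op.apply]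

theorem run_sqLenE (hP : run env P = some (encodeLine L)) :
    run env (sqLenE P) = some (.real (sqLen L)) := by
  simp [sqLenE, sqLen, run, fstE, sndE, hP, encodePoint, encodeLine, Op.apply]

theorem run_crossE (hP : run env P = some (encodeLine L)) (hQ : run env Q = some (encodePoint q)) :
    run env (crossE P Q) = some (.real (cross L q)) := by
  simp [crossE, cross, run, fstE, sndE, hP, hQ, encodePoint, encodeLine, Op.apply]

theorem run_sqCrossE (hP : run env P = some (encodeLine L))
    (hQ : run env Q = some (encodePoint q)) :
    run env (sqCrossE P Q) = some (.real (sqCross L q)) := by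
  simp [sqCrossE, sqCross, run, run_crossE hP hQ, Op.apply]

theorem run_lineThroughE (hP : run env P = some (encodePoint p))
    (hQ : run env Q = some (encodePoint q)) :
    run env (lineThroughE P Q) = some (encodeLine (lineThrough p q)) := by
  simp only [lineThroughE, lineThrough, run, run_sqDistE hP hQ, hP, Rat.cast_zero]
  split_ifs <;> simp [run, fstE, sndE, hP, hQ, encodePoint, encodeLine, Op.apply]

theorem run_maxE {x y : ℝ} (hP : run env P = some (.real x)) (hQ : run env Q = some (.real y)) :
    run env (maxE P Q) = some (.real (max x y)) := by
  simp only [maxE, run, hP, hQ, max_def]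
  split_ifs <;> rfl

theorem run_minE {x y : ℝ} (hP : run env P = some (.real x)) (hQ : run env Q = some (.real y)) :
    run env (minE P Q) = some (.real (min x y)) := by
  simp only [minE, run, hP, hQ, min_def]
  split_ifs <;> rfl

end RealProg

namespace RealProg

/-! ### Selection -/

/-- The median of five numbers. -/
noncomputable def medianFive (a b c d e : ℝ) : ℝ :=
  max (min a (min (max e d) (max c b)))
    (min (max a (min (max e d) (max c b))) (max (min e d) (min c b)))

theorem medianFive_mem (a b c d e : ℝ) : medianFive a b c d e ∈ [a, b, c, d, e] := by
  have hM : ∀ x y, x ∈ [a, b, c, d, e] → y ∈ [a, b, c, d, e] → max x y ∈ [a, b, c, d, e] :=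
    fun x y hx hy => max_rec' (· ∈ [a, b, c, d, e]) hx hy
  have hm : ∀ x y, x ∈ [a, b, c, d, e] → y ∈ [a, b, c, d, e] → min x y ∈ [a, b, c, d, e] :=
    fun x y hx hy => min_rec' (· ∈ [a, b, c, d, e]) hx hy
  unfold medianFive
  refine hM _ _ (hm _ _ ?_ (hm _ _ (hM _ _ ?_ ?_) (hM _ _ ?_ ?_)))
    (hm _ _ (hM _ _ ?_ (hm _ _ (hM _ _ ?_ ?_) (hM _ _ ?_ ?_)))
      (hM _ _ (hm _ _ ?_ ?_) (hm _ _ ?_ ?_))) <;> simp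

/-- In the pairs (b,c) and (d,e), the smaller minimum and the larger maximum are dropped;
`medianFive` is the median of the remaining three. The claim depends only on which of the five
comparisons with `x` hold, hence the 32 cases. -/
theorem three_le_countP_of_le_medianFive {x a b c d e : ℝ} (h : x ≤ medianFive a b c d e) :
    3 ≤ [a, b, c, d, e].countP (x ≤ ·) := by
  simp only [medianFive, le_max_iff, le_min_iff] at h
  by_cases ha : x ≤ a <;> by_cases hb : x ≤ b <;> by_cases hc : x ≤ c <;>
    by_cases hd : x ≤ d <;> by_cases he : x ≤ e <;>
    simp [ha, hb, hc, hd, he] at h ⊢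

theorem three_le_countP_of_medianFive_le {x a b c d e : ℝ} (h : medianFive a b c d e ≤ x) :
    3 ≤ [a, b, c, d, e].countP (· ≤ x) := by
  simp only [medianFive, max_le_iff, min_le_iff] at h
  by_cases ha : a ≤ x <;> by_cases hb : b ≤ x <;> by_cases hc : c ≤ x <;>
    by_cases hd : d ≤ x <;> by_cases he : e ≤ x <;>
    simp [ha, hb, hc, hd, he] at h ⊢

/-- Medians of groups of five consecutive elements. -/
noncomputable def medians : List ℝ → List ℝ
  | a :: b :: c :: d :: e :: l => medianFive a b c d e :: medians l
  | _ => []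

theorem length_medians (l : List ℝ) :
    5 * (medians l).length ≤ l.length ∧ l.length ≤ 5 * (medians l).length + 4 := by
  fun_induction medians l with
  | case1 a b c d e l ih =>
    simp only [List.length_cons]
    omega
  | case2 l h =>
    refine ⟨by simp, ?_⟩
    match l, h with
    | [], _ | [_], _ | [_, _], _ | [_, _, _], _ | [_, _, _, _], _ => simp
    | a :: b :: c :: d :: e :: l, h => exact absurd rfl (h a b c d e l)

theorem medians_subset (l : List ℝ) : medians l ⊆ l := by
  fun_induction medians l with
  | case1 a b c d e l ih =>
    intro x hx
    rcases List.mem_cons.1 hx with rfl | hx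
    · have := medianFive_mem a b c d e
      simp only [List.mem_cons, List.not_mem_nil, or_false] at this ⊢
      tauto
    · simp only [List.mem_cons, ih hx, or_true]
  | case2 l h => simp

/-- Each group whose median is at least `x` contributes three such elements; at most four elements
belong to no group. -/
theorem countP_le_medians (x : ℝ) (l : List ℝ) :
    3 * (medians l).countP (x ≤ ·) ≤ l.countP (x ≤ ·) := by
  fun_induction medians l with
  | case1 a b c d e l ih =>
    have key : (a :: b :: c :: d :: e :: l) = [a, b, c, d, e] ++ l := rfl
    rw [key, List.countP_append, List.countP_cons]
    split_ifs with h
    · have := three_le_countP_of_le_medianFive (of_decide_eq_true h)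
      omega
    · omega
  | case2 l h => simp

theorem countP_medians_le (x : ℝ) (l : List ℝ) :
    3 * (medians l).countP (· ≤ x) ≤ l.countP (· ≤ x) := by
  fun_induction medians l with
  | case1 a b c d e l ih =>
    have key : (a :: b :: c :: d :: e :: l) = [a, b, c, d, e] ++ l := rfl
    rw [key, List.countP_append, List.countP_cons]
    split_ifs with h
    · have := three_le_countP_of_medianFive_le (of_decide_eq_true h)
      omega
    · omega
  | case2 l h => simp

theorem evalLe_medians (l : List ℝ) :
    EvalLe twoLineFns [encodeList .real l] mediansBody (encodeList .real (medians l))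
      (1000 * (l.length + 1)) := by
  fun_induction medians l with
  | case1 a b c d e l ih =>
    refine (EvalLe.cases_pair 2 (by decide) rfl <| EvalLe.cases_pair 2 (by decide) rfl <|
      EvalLe.cases_pair 2 (by decide) rfl <| EvalLe.cases_pair 2 (by decide) rfl <|
      EvalLe.cases_pair 2 (by decide) rfl <| EvalLe.pair (EvalLe.of_run_le 500 (by decide) ?_) <|
      EvalLe.call 2 (by decide) rfl rfl ih).mono ?_
    · have hv : ∀ {env : List Val} {i : ℕ} {v : Val}, env[i]? = some v → run env (.var i) = some v :=
        fun h => by simpa [run] using h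
      simp only [run]
      rw [run_maxE (run_minE (hv rfl) (hv rfl)) (run_minE (hv rfl) (hv rfl))]
      dsimp only
      rw [run_minE (run_maxE (hv rfl) (hv rfl)) (run_maxE (hv rfl) (hv rfl))]
      dsimp only
      rw [run_maxE (run_minE (hv rfl) (hv rfl)) (run_minE (run_maxE (hv rfl) (hv rfl)) (hv rfl))]
      rfl
    · simp only [List.length_cons]
      omega
  | case2 l h =>
    have h₀ : ∀ {env : List Val} {e₂ : Expr}, env[1]? = some .nil →
        EvalLe twoLineFns env (.cases (.var 1) .nil e₂) .nil 3 := fun h =>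
      EvalLe.cases_nil 2 (by decide) (by simpa [run] using h) (.of_run_le 1 (by decide) rfl)
    refine EvalLe.mono (B₁ := 11) ?_ (by omega)
    match l, h with
    | [], _ =>
      exact (EvalLe.cases_nil 2 (by decide) rfl (.of_run_le 1 (by decide) rfl)).mono (by decide)
    | [_], _ =>
      exact (EvalLe.cases_pair 2 (by decide) rfl <|
        h₀ rfl).mono (by decide)
    | [_, _], _ =>
      exact (EvalLe.cases_pair 2 (by decide) rfl <|
        EvalLe.cases_pair 2 (by decide) rfl <|
        h₀ rfl).mono (by decide)
    | [_, _, _], _ =>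
      exact (EvalLe.cases_pair 2 (by decide) rfl <|
        EvalLe.cases_pair 2 (by decide) rfl <|
        EvalLe.cases_pair 2 (by decide) rfl <|
        h₀ rfl).mono (by decide)
    | [_, _, _, _], _ =>
      exact (EvalLe.cases_pair 2 (by decide) rfl <|
        EvalLe.cases_pair 2 (by decide) rfl <|
        EvalLe.cases_pair 2 (by decide) rfl <|
        EvalLe.cases_pair 2 (by decide) rfl <|
        h₀ rfl).mono (by decide)
    | a :: b :: c :: d :: e :: l, h => exact absurd rfl (h a b c d e l)

/-- `m` is an element of rank `k` of the list `l`. -/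
def HasRank (l : List ℝ) (k m : ℝ) : Prop :=
  m ∈ l ∧ (l.countP (· < m) : ℝ) < k ∧ k ≤ l.countP (· ≤ m)

theorem countP_lt_add_le (l : List ℝ) (x : ℝ) : l.countP (x < ·) + l.countP (· ≤ x) = l.length := by
  rw [List.length_eq_countP_add_countP (fun y => x < y)]
  simp

theorem countP_le_add_lt (l : List ℝ) (x : ℝ) : l.countP (x ≤ ·) + l.countP (· < x) = l.length := by
  rw [List.length_eq_countP_add_countP (fun y => x ≤ y)]
  simp

/-- The discarded elements are at least `p > m`, so they enter neither count at `m`. -/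
theorem HasRank.of_lt {l l' : List ℝ} {p k m : ℝ} (hl : l' = (l.filter (· < p)).reverse)
    (h : HasRank l' k m) : HasRank l k m := by
  subst hl
  obtain ⟨h₁, h₂, h₃⟩ := h
  have hm : m ∈ l ∧ m < p := by simpa using h₁
  rw [List.countP_reverse, List.countP_filter] at h₂ h₃
  refine ⟨hm.1, ?_, ?_⟩
  · convert h₂ using 5 with y
    simpa using fun h => h.trans hm.2
  · refine h₃.trans ?_
    exact_mod_cast List.countP_mono_left fun y _ h => by simp_all

/-- The discarded elements are at most `p < m`, so they enter both counts at `m` and the rank shifts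
by their number. -/
theorem HasRank.of_gt {l l' : List ℝ} {p k m : ℝ} (hl : l' = (l.filter (p < ·)).reverse)
    (h : HasRank l' (k - l.countP (· ≤ p)) m) : HasRank l k m := by
  subst hl
  obtain ⟨h₁, h₂, h₃⟩ := h
  have hm : m ∈ l ∧ p < m := by simpa using h₁
  have key : ∀ q : ℝ → Bool, (∀ y ≤ p, q y = true) →
      l.countP q = (l.filter (p < ·)).reverse.countP q + l.countP (· ≤ p) := by
    intro q hq
    rw [List.countP_reverse, List.countP_filter, List.countP_eq_countP_filter_add l q (p < ·)]
    congr 1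
    · rw [List.countP_filter]
    · rw [List.countP_filter]
      congr 1
      ext y
      have := hq y
      by_cases h : y ≤ p <;> simp_all
  refine ⟨hm.1, ?_, ?_⟩
  · rw [key (· < m) fun y hy => by simpa using hy.trans_lt hm.2]
    push_cast
    linarith
  · rw [key (· ≤ m) fun y hy => by simpa using hy.trans hm.2.le]
    push_cast
    linarith

/-- Median of medians: the pivot is the median of about n/5 medians, and at least about 3n/10
elements lie on each side of it, so the two recursive calls together concern about 9n/10 elements.
-/
theorem exists_evalLe_select (n : ℕ) : ∀ (l : List ℝ) (k : ℝ), l.length = n → 0 < k → k ≤ n →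
    ∃ m, HasRank l k m ∧ EvalLe twoLineFns [.pair (.real k) (encodeList .real l)] selectBody
      (.real m) (360000 * n) := by
  induction n using Nat.strong_induction_on with
  | _ n ih =>
  intro l k hl hk₀ hk
  have hn : 0 < n := by exact_mod_cast hk₀.trans_le hk
  obtain ⟨hM₁, hM₂⟩ := length_medians l
  set M := medians l with hM
  obtain ⟨p, B, hpl, hB, hp₁, hp₂, hp⟩ : ∃ p B, p ∈ l ∧ B ≤ 360000 * M.length + 100 ∧
      3 * M.length ≤ 2 * l.countP (p ≤ ·) ∧ 3 * M.length ≤ 2 * l.countP (· ≤ p) ∧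
      EvalLe twoLineFns [.real M.length, encodeList .real M,
        .pair (.real k) (encodeList .real l)] (.cases (.var 1) (fstE (sndE (.var 2)))
        (.call 4 (.pair (.op .mul (.const (1 / 2)) (.var 2)) (.var 3)))) (.real p) B := by
    rcases hM' : M with _ | ⟨a, M'⟩
    -- Fewer than five elements give no median; the head then serves as pivot.
    · obtain ⟨p, l', rfl⟩ := List.exists_cons_of_length_pos (hl ▸ hn)
      exact ⟨p, 100, by simp, by simp, by simp, by simp,
        (EvalLe.cases_nil 50 (by decide) rfl (.of_run_le 50 (by decide) rfl))⟩
    · rw [← hM']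
      have hpos : 0 < M.length := by simp [hM']
      -- Ranks are real numbers, so half the length needs no rounding.
      obtain ⟨p, ⟨h₁, h₂, h₃⟩, h₄⟩ := ih M.length (by omega) M ((1 / 2 : ℚ) * M.length : ℝ) rfl
        (by positivity) (by push_cast; linarith [(Nat.cast_nonneg M.length : (0 : ℝ) ≤ _)])
      have e₁ : 2 * M.countP (· < p) < M.length := by
        have : 2 * (M.countP (· < p) : ℝ) < M.length := by push_cast at h₂; linarith
        exact_mod_cast this
      have e₂ : M.length ≤ 2 * M.countP (· ≤ p) := by
        have : (M.length : ℝ) ≤ 2 * M.countP (· ≤ p) := by push_cast at h₃; linarith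
        exact_mod_cast this
      have e₃ := countP_le_add_lt M p
      have e₄ := countP_le_medians p l
      have e₅ := countP_medians_le p l
      rw [← hM] at e₄ e₅
      refine ⟨p, 360000 * M.length + 100, medians_subset l h₁, le_rfl, by omega, by omega, ?_⟩
      refine (EvalLe.cases_pair (a := .real a) (b := encodeList .real M') 50 (by decide)
        (by simp [run, hM', encodeList]) (EvalLe.call 50 (by decide) ?_ rfl h₄)).mono (by omega)
      simp [run, Op.apply]
  set lt := (l.filter (· < p)).reverse with hlt
  set gt := (l.filter (p < ·)).reverse with hgt
  have hlt' : lt.length = l.countP (· < p) := by simp [hlt, List.countP_eq_length_filter]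
  have hgt' : gt.length = l.countP (p < ·) := by simp [hgt, List.countP_eq_length_filter]
  have c₁ := countP_le_add_lt l p
  have c₂ := countP_lt_add_le l p
  have c₃ : 0 < l.countP (p ≤ ·) := List.countP_pos_iff.2 ⟨p, hpl, by simp⟩
  have c₄ : 0 < l.countP (· ≤ p) := List.countP_pos_iff.2 ⟨p, hpl, by simp⟩
  have c₅ : (l.countP (· ≤ p) : ℝ) = l.length - gt.length := by
    rw [hgt', ← c₂]
    push_cast
    ring
  -- Two sources pay for the linear scans: the second inequality saves half of `M.length` when there
  -- are medians, and `n' < n` saves one unit when there are none.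
  obtain ⟨m, n', hm, hn₁, hn₂, hfin⟩ : ∃ m n', HasRank l k m ∧ n' < n ∧
      2 * n' + 3 * M.length ≤ 2 * n ∧ EvalLe twoLineFns [.real l.length, .real gt.length,
        .real lt.length, encodeList .real gt, encodeList .real lt, .real p, .real M.length,
        encodeList .real M, .pair (.real k) (encodeList .real l)]
        (.ifLe (fstE (.var 8)) (.var 2) (.call 4 (.pair (fstE (.var 8)) (.var 4))) <|
          .ifLe (fstE (.var 8)) (.op .sub (.var 0) (.var 1)) (.var 5) <|
          .call 4 (.pair (.op .sub (fstE (.var 8)) (.op .sub (.var 0) (.var 1))) (.var 3)))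
        (.real m) (360000 * n' + 200) := by
    by_cases h₁ : k ≤ lt.length
    · obtain ⟨m, hm, h⟩ := ih lt.length (by omega) lt k rfl hk₀ h₁
      refine ⟨m, lt.length, hm.of_lt hlt, by omega, by omega, ?_⟩
      exact (EvalLe.ifLe 50 (by decide) rfl rfl (fun _ => EvalLe.call 50 (by decide) rfl rfl h)
        (fun h => absurd h₁ h)).mono (by omega)
    by_cases h₂ : k ≤ l.length - gt.length
    · refine ⟨p, 0, ⟨hpl, ?_, ?_⟩, hn, by omega, ?_⟩
      · rw [← hlt']
        exact not_le.1 h₁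
      · rwa [c₅]
      · exact (EvalLe.ifLe 50 (by decide) rfl rfl (fun h => absurd h h₁) fun _ =>
          EvalLe.ifLe 50 (by decide) rfl rfl (fun _ => EvalLe.of_run_le 50 (by decide) rfl)
          (fun h => absurd h₂ h)).mono (by omega)
    · obtain ⟨m, hm, h⟩ := ih gt.length (by omega) gt (k - (l.length - gt.length)) rfl
        (by linarith) (by rw [hl]; linarith)
      refine ⟨m, gt.length, HasRank.of_gt hgt (by rwa [c₅]), by omega, by omega, ?_⟩
      exact (EvalLe.ifLe 50 (by decide) rfl rfl (fun h => absurd h h₁) fun _ =>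
          EvalLe.ifLe 50 (by decide) rfl rfl (fun h => absurd h h₂) fun _ =>
          EvalLe.call 50 (by decide) rfl rfl h).mono (by omega)
  refine ⟨m, hm, ?_⟩
  have s₁ : lt.length ≤ n := by omega
  have s₂ : gt.length ≤ n := by omega
  have s₃ : M.length ≤ n := by omega
  refine (EvalLe.letIn (EvalLe.call 50 (by decide) rfl rfl (evalLe_medians l)) <|
    EvalLe.letIn (EvalLe.call_count (l := M) 1000 .real (by decide) rfl ?_ s₃) <|
    EvalLe.letIn hp <|
    EvalLe.letIn (EvalLe.call_drop (l := l) (out := []) 1000 .real (fun _ => p) (fun x => x)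
      (.real p) (by decide) rfl (fun _ _ _ _ _ => rfl) (fun _ _ _ _ _ => rfl) rfl hl.le).sndE <|
    EvalLe.letIn (EvalLe.call_drop (l := l) (out := []) 1000 .real (fun x => x) (fun _ => p)
      (.real p) (by decide) rfl (fun _ _ _ _ _ => rfl) (fun _ _ _ _ _ => rfl) rfl hl.le).sndE <|
    EvalLe.letIn (EvalLe.call_count (l := lt) 1000 .real (by decide) rfl ?_ s₁) <|
    EvalLe.letIn (EvalLe.call_count (l := gt) 1000 .real (by decide) rfl ?_ s₂) <|
    EvalLe.letIn (B₂ := 360000 * n' + 200) (EvalLe.call_count (l := l) 1000 .real (by decide) rfl ?_ hl.le)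
      ?_).mono ?_
  rotate_left 4
  · simpa only [List.append_nil] using hfin
  · omega
  all_goals simp [run, sndE, hlt, hgt, hM]

end RealProg

namespace TwoLineCenter

/-! ### Distances to lines -/

/-- Squared distance to a line. -/
noncomputable def lineDist (L : (ℝ × ℝ) × (ℝ × ℝ)) (z : ℝ × ℝ) : ℝ := sqCross L z / sqLen L

theorem sqDist_nonneg (p q : ℝ × ℝ) : 0 ≤ sqDist p q := by
  unfold sqDist
  exact add_nonneg (mul_self_nonneg _) (mul_self_nonneg _)

theorem sqDist_self (p : ℝ × ℝ) : sqDist p p = 0 := by simp [sqDist]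

theorem eq_of_sqDist_le_zero {p q : ℝ × ℝ} (h : sqDist p q ≤ 0) : q = p := by
  unfold sqDist at h
  ext <;> nlinarith [mul_self_nonneg (q.1 - p.1), mul_self_nonneg (q.2 - p.2)]

theorem sqCross_nonneg (L : (ℝ × ℝ) × (ℝ × ℝ)) (z : ℝ × ℝ) : 0 ≤ sqCross L z :=
  mul_self_nonneg _

theorem sqLen_nonneg (L : (ℝ × ℝ) × (ℝ × ℝ)) : 0 ≤ sqLen L := by
  unfold sqLen
  exact add_nonneg (mul_self_nonneg _) (mul_self_nonneg _)

theorem lineThrough_of_pos {p q : ℝ × ℝ} (h : ¬ sqDist p q ≤ 0) :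
    lineThrough p q = (p, (q.1 - p.1, q.2 - p.2)) := by
  simp only [lineThrough, if_neg h]

theorem sqLen_lineThrough_of_pos {p q : ℝ × ℝ} (h : ¬ sqDist p q ≤ 0) :
    sqLen (lineThrough p q) = sqDist p q := by
  rw [lineThrough_of_pos h]
  rfl

theorem sqLen_lineThrough_pos (p q : ℝ × ℝ) : 0 < sqLen (lineThrough p q) := by
  by_cases h : sqDist p q ≤ 0
  · simp [sqLen, lineThrough, h]
  · rw [sqLen_lineThrough_of_pos h]
    exact not_le.1 h

theorem lineDist_nonneg (L : (ℝ × ℝ) × (ℝ × ℝ)) (z : ℝ × ℝ) : 0 ≤ lineDist L z :=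
  div_nonneg (sqCross_nonneg _ _) (sqLen_nonneg _)

theorem sqCross_lineThrough_self (p q : ℝ × ℝ) : sqCross (lineThrough p q) p = 0 := by
  simp [sqCross, cross, lineThrough]

theorem lineDist_lineThrough_self (p q : ℝ × ℝ) : lineDist (lineThrough p q) p = 0 := by
  simp [lineDist, sqCross_lineThrough_self]

theorem Slab.sub_le_width (σ : Slab) {w : ℝ} (hw : σ.width ≤ w) :
    ∃ N > 0, N * N = σ.a * σ.a + σ.b * σ.b ∧ σ.hi - σ.lo ≤ w * N := by
  have hpos : 0 < σ.a ^ 2 + σ.b ^ 2 := by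
    rcases σ.normal_ne_zero with h | h <;> positivity
  refine ⟨_, Real.sqrt_pos.2 hpos, ?_, ?_⟩
  · rw [Real.mul_self_sqrt hpos.le]
    ring
  · exact (div_le_iff₀ (Real.sqrt_pos.2 hpos)).1 hw

/-- If `o`, `q` and `z` lie in a slab, then the line through `o` and `q` is close to `z`. -/
theorem lineDist_le_of_mem_slab {σ : Slab} {w κ : ℝ} (hw : σ.width ≤ w) (hκ : 0 ≤ κ)
    {o q z : ℝ × ℝ} (ho : o ∈ σ.region) (hq : q ∈ σ.region) (hz : z ∈ σ.region)
    (h : sqDist o z ≤ κ ^ 2 * sqDist o q) :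
    lineDist (lineThrough o q) z ≤ ((1 + κ) * w) ^ 2 := by
  -- If `o` and `q` coincide, the hypothesis forces `z = o`.
  by_cases h₀ : sqDist o q ≤ 0
  · have : z = o := eq_of_sqDist_le_zero (h.trans (mul_nonpos_of_nonneg_of_nonpos (by positivity) h₀))
    rw [this, lineDist_lineThrough_self]
    positivity
  obtain ⟨N, hN, hNN, hwN⟩ := σ.sub_le_width hw
  have hw₀ : 0 ≤ w := le_trans (div_nonneg (sub_nonneg.2 σ.lo_le_hi) (Real.sqrt_nonneg _)) hw
  rw [lineDist, div_le_iff₀ (sqLen_lineThrough_pos _ _)]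
  have hlen := sqLen_lineThrough_of_pos h₀
  have hcr : sqCross (lineThrough o q) z =
      ((q.1 - o.1) * (z.2 - o.2) - (q.2 - o.2) * (z.1 - o.1)) ^ 2 := by
    rw [lineThrough_of_pos h₀, pow_two]
    rfl
  rw [hlen, hcr]
  obtain ⟨o₁, o₂⟩ := ho
  obtain ⟨q₁, q₂⟩ := hq
  obtain ⟨z₁, z₂⟩ := hz
  obtain ⟨U, hU, hUU⟩ : ∃ U, 0 ≤ U ∧ U * U = sqDist o q :=
    ⟨_, Real.sqrt_nonneg _, Real.mul_self_sqrt (sqDist_nonneg o q)⟩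
  rw [← hUU] at h ⊢
  simp only [sqDist] at h hUU
  set u₁ := q.1 - o.1 with hu₁
  set u₂ := q.2 - o.2 with hu₂
  set v₁ := z.1 - o.1 with hv₁
  set v₂ := z.2 - o.2 with hv₂
  -- In the frame of the slab, `a₁` and `a₂` bound the normal components by the width, `a₃` and `a₄`
  -- the tangential ones by the full lengths.
  have a₁ : |σ.a * u₁ + σ.b * u₂| ≤ w * N := by
    rw [hu₁, hu₂]
    exact abs_le.2 ⟨by linarith, by linarith⟩
  have a₂ : |σ.a * v₁ + σ.b * v₂| ≤ w * N := by
    rw [hv₁, hv₂]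
    exact abs_le.2 ⟨by linarith, by linarith⟩
  have a₃ : |σ.a * u₂ - σ.b * u₁| ≤ N * U := by
    refine abs_le_of_sq_le_sq ?_ (by positivity)
    have : (N * U) ^ 2 = (σ.a * σ.a + σ.b * σ.b) * (u₁ * u₁ + u₂ * u₂) := by
      rw [← hNN, ← hUU]; ring
    rw [this]
    have e : (σ.a * σ.a + σ.b * σ.b) * (u₁ * u₁ + u₂ * u₂) =
        (σ.a * u₁ + σ.b * u₂) ^ 2 + (σ.a * u₂ - σ.b * u₁) ^ 2 := by ring
    rw [e]
    exact le_add_of_nonneg_left (sq_nonneg _)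
  have a₄ : |σ.a * v₂ - σ.b * v₁| ≤ N * (κ * U) := by
    refine abs_le_of_sq_le_sq ?_ (by positivity)
    have : (N * (κ * U)) ^ 2 = (σ.a * σ.a + σ.b * σ.b) * (κ ^ 2 * (U * U)) := by
      rw [← hNN]; ring
    rw [this]
    refine le_trans ?_
      (mul_le_mul_of_nonneg_left h (add_nonneg (mul_self_nonneg σ.a) (mul_self_nonneg σ.b)))
    have e : (σ.a * σ.a + σ.b * σ.b) * (v₁ * v₁ + v₂ * v₂) =
        (σ.a * v₁ + σ.b * v₂) ^ 2 + (σ.a * v₂ - σ.b * v₁) ^ 2 := by ring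
    rw [e]
    exact le_add_of_nonneg_left (sq_nonneg _)
  -- The cross product in the rotated frame: each of its two terms is a normal component times a
  -- tangential one.
  have a₅ : |u₁ * v₂ - u₂ * v₁| ≤ (1 + κ) * w * U := by
    refine le_of_mul_le_mul_right ?_ (mul_pos hN hN)
    calc |u₁ * v₂ - u₂ * v₁| * (N * N)
        = |(σ.a * u₁ + σ.b * u₂) * (σ.a * v₂ - σ.b * v₁)
            - (σ.a * u₂ - σ.b * u₁) * (σ.a * v₁ + σ.b * v₂)| := by
          rw [← abs_of_pos (mul_pos hN hN), ← abs_mul, hNN]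
          congr 1
          ring
      _ ≤ |σ.a * u₁ + σ.b * u₂| * |σ.a * v₂ - σ.b * v₁|
            + |σ.a * u₂ - σ.b * u₁| * |σ.a * v₁ + σ.b * v₂| := by
          rw [← abs_mul, ← abs_mul]
          exact abs_sub _ _
      _ ≤ w * N * (N * (κ * U)) + N * U * (w * N) := by gcongr
      _ = (1 + κ) * w * U * (N * N) := by ring
  calc (u₁ * v₂ - u₂ * v₁) ^ 2 = |u₁ * v₂ - u₂ * v₁| ^ 2 := (sq_abs _).symm
    _ ≤ ((1 + κ) * w * U) ^ 2 := by gcongr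
    _ = ((1 + κ) * w) ^ 2 * (U * U) := by ring

/-- Change of the line through the base point `o`. -/
theorem lineDist_lineThrough_le {o x y z : ℝ × ℝ} (h : sqDist o z ≤ sqDist o y) :
    lineDist (lineThrough o x) z ≤
      2 * lineDist (lineThrough o y) z + 2 * lineDist (lineThrough o x) y := by
  by_cases h₀ : sqDist o y ≤ 0
  · rw [eq_of_sqDist_le_zero (h.trans h₀), lineDist_lineThrough_self]
    have := lineDist_nonneg (lineThrough o y) o
    have := lineDist_nonneg (lineThrough o x) y
    positivity
  have hF := sqLen_lineThrough_pos o x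
  have hY : 0 < sqDist o y := not_le.1 h₀
  have hc : ∀ x p, sqCross (lineThrough o x) p =
      ((lineThrough o x).2.1 * (p.2 - o.2) - (lineThrough o x).2.2 * (p.1 - o.1)) ^ 2 :=
    fun x p => (pow_two _).symm
  have hl : sqLen (lineThrough o x) = (lineThrough o x).2.1 ^ 2 + (lineThrough o x).2.2 ^ 2 := by
    simp only [sqLen, pow_two]
  rw [lineDist, lineDist, lineDist, hc, hc, hc x y, sqLen_lineThrough_of_pos h₀,
    lineThrough_of_pos h₀, div_le_iff₀ hF, add_mul, mul_assoc 2 (_ / sqLen _),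
    div_mul_cancel₀ _ hF.ne', mul_assoc, div_mul_eq_mul_div, ← sub_nonneg]
  -- Cauchy–Schwarz by Lagrange's identity; only here does it matter that `z` is no farther from `o`
  -- than `y`.
  have hzy : ((z.1 - o.1) * (y.1 - o.1) + (z.2 - o.2) * (y.2 - o.2)) ^ 2 ≤ sqDist o y ^ 2 := by
    have e : ((z.1 - o.1) * (y.1 - o.1) + (z.2 - o.2) * (y.2 - o.2)) ^ 2 =
        sqDist o z * sqDist o y - ((y.1 - o.1) * (z.2 - o.2) - (y.2 - o.2) * (z.1 - o.1)) ^ 2 := by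
      simp only [sqDist]
      ring
    rw [e, pow_two]
    have := mul_le_mul_of_nonneg_right h hY.le
    linarith [sq_nonneg ((y.1 - o.1) * (z.2 - o.2) - (y.2 - o.2) * (z.1 - o.1))]
  have hYd : sqDist o y = (y.1 - o.1) ^ 2 + (y.2 - o.2) ^ 2 := by
    simp only [sqDist, pow_two]
  generalize (lineThrough o x).2.1 = f₁ at *
  generalize (lineThrough o x).2.2 = f₂ at *
  generalize sqLen (lineThrough o x) = F at *
  generalize sqDist o y = Y at *
  simp only
  generalize y.1 - o.1 = y₁ at *
  generalize y.2 - o.2 = y₂ at *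
  generalize z.1 - o.1 = z₁ at *
  generalize z.2 - o.2 = z₂ at *
  have hfy : (f₁ * y₁ + f₂ * y₂) ^ 2 ≤ F * Y := by
    rw [hl, hYd]
    linarith [sq_nonneg (f₁ * y₂ - f₂ * y₁)]
  -- Splitting `z` along and across `y` gives (f×z)|y|² = (y×z)(f·y) + (f×y)(z·y); the factors 2
  -- come from (s + t)² ≤ 2s² + 2t².
  have key : ((f₁ * z₂ - f₂ * z₁) * Y) ^ 2 ≤
      2 * ((y₁ * z₂ - y₂ * z₁) ^ 2 * (F * Y)) + 2 * ((f₁ * y₂ - f₂ * y₁) ^ 2 * Y ^ 2) := by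
    have e : (f₁ * z₂ - f₂ * z₁) * Y = (y₁ * z₂ - y₂ * z₁) * (f₁ * y₁ + f₂ * y₂) +
        (f₁ * y₂ - f₂ * y₁) * (z₁ * y₁ + z₂ * y₂) := by
      rw [hYd]
      ring
    rw [e]
    have e₁ := mul_le_mul_of_nonneg_left hfy (sq_nonneg (y₁ * z₂ - y₂ * z₁))
    have e₂ := mul_le_mul_of_nonneg_left hzy (sq_nonneg (f₁ * y₂ - f₂ * y₁))
    nlinarith [sq_nonneg ((y₁ * z₂ - y₂ * z₁) * (f₁ * y₁ + f₂ * y₂) -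
        (f₁ * y₂ - f₂ * y₁) * (z₁ * y₁ + z₂ * y₂))]
  have e : 2 * ((y₁ * z₂ - y₂ * z₁) ^ 2 * F / Y) + 2 * (f₁ * y₂ - f₂ * y₁) ^ 2 -
      (f₁ * z₂ - f₂ * z₁) ^ 2 = (2 * ((y₁ * z₂ - y₂ * z₁) ^ 2 * (F * Y)) +
      2 * ((f₁ * y₂ - f₂ * y₁) ^ 2 * Y ^ 2) - ((f₁ * z₂ - f₂ * z₁) * Y) ^ 2) / Y ^ 2 := by
    field_simp
  rw [e]
  exact div_nonneg (sub_nonneg.2 key) (sq_nonneg _)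

end TwoLineCenter

namespace TwoLineCenter

/-! ### The search for the second line -/

/-- The state of the search for the second line, given the first line `L`, a base point `o` of the
second line and a bound `τ` for the squared distances. The points of `F` are those that have been
assigned to the second line, the list `Q` represents them, with error `H`, and `q` is the farthest
of them; the points of the list `U` have not been assigned yet. -/
structure SearchInv (S : Set (ℝ × ℝ)) (L : (ℝ × ℝ) × (ℝ × ℝ)) (o : ℝ × ℝ) (τ : ℝ)
    (F : Set (ℝ × ℝ)) (U Q : List (ℝ × ℝ)) (H : ℝ) (q : ℝ × ℝ) : Prop where
  mem_of_mem : ∀ z ∈ U, z ∈ S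
  subset : F ⊆ S
  notMem : ∀ z ∈ U, z ∉ F
  old : ∀ y ∈ Q, y ∈ insert o F
  cover : ∀ z ∈ F, ∃ y ∈ Q, sqDist o z ≤ sqDist o y ∧ lineDist (lineThrough o y) z ≤ H
  -- The recorded error is never more than the points force; this lets `FarCovered` bound it.
  err_le : ∀ b, 0 ≤ b → (∀ z ∈ insert o F, ∀ y ∈ insert o F, sqDist o z ≤ sqDist o y →
    lineDist (lineThrough o y) z ≤ b) → H ≤ b
  far_mem : q ∈ insert o F
  far : ∀ z ∈ F, sqDist o z ≤ sqDist o q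
  -- Either the current cut already succeeds, or only points beyond the bound have been assigned and
  -- only points within it discarded.
  main : ((∀ z ∈ F, lineDist (lineThrough o q) z ≤ τ) ∧
      ∀ z ∈ S, z ∉ F → sqCross L z ≤ τ * sqLen L) ∨
    ((∀ z ∈ F, τ * sqLen L < sqCross L z) ∧
      ∀ z ∈ S, z ∉ F → z ∉ U → sqCross L z ≤ τ * sqLen L)

variable {S : Set (ℝ × ℝ)} {L : (ℝ × ℝ) × (ℝ × ℝ)} {o : ℝ × ℝ} {τ β : ℝ}
  {F : Set (ℝ × ℝ)} {U U' Q : List (ℝ × ℝ)} {H G m : ℝ} {q q' : ℝ × ℝ}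

theorem SearchInv.init (hU : ∀ z, z ∈ U ↔ z ∈ S) : SearchInv S L o τ ∅ U [] 0 o where
  mem_of_mem z hz := (hU z).1 hz
  subset := Set.empty_subset _
  notMem _ _ := Set.notMem_empty _
  old := by simp
  cover := by simp
  err_le _ hb _ := hb
  far_mem := by simp
  far := by simp
  main := Or.inr ⟨by simp, fun z hz _ h => absurd ((hU z).2 hz) h⟩

/-- The points with a great distance to the first line can be covered by the second line. -/
def FarCovered (S : Set (ℝ × ℝ)) (L : (ℝ × ℝ) × (ℝ × ℝ)) (o : ℝ × ℝ) (τ β : ℝ) : Prop :=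
  ∀ z ∈ insert o {z ∈ S | τ * sqLen L < sqCross L z},
    ∀ y ∈ insert o {z ∈ S | τ * sqLen L < sqCross L z},
      sqDist o z ≤ sqDist o y → lineDist (lineThrough o y) z ≤ β

/-- In the second alternative of the invariant, `F` consists of far points, so `FarCovered` applies
directly to `q` and gives the error β without the factor 4. -/
theorem SearchInv.final (h : SearchInv S L o τ F [] Q H q) (hF : FarCovered S L o τ β)
    (hβ : 0 ≤ β) (hτ : 4 * β ≤ τ) :
    ∀ z ∈ S, sqCross L z ≤ τ * sqLen L ∨ lineDist (lineThrough o q) z ≤ τ := by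
  intro z hz
  rcases h.main with ⟨h₁, h₂⟩ | ⟨h₁, h₂⟩
  · by_cases hzF : z ∈ F
    · exact .inr (h₁ z hzF)
    · exact .inl (h₂ z hz hzF)
  · by_cases hzF : z ∈ F
    · have hsub : F ⊆ {z ∈ S | τ * sqLen L < sqCross L z} := fun y hy => ⟨h.subset hy, h₁ y hy⟩
      exact .inr ((hF z (.inr (hsub hzF)) q (Set.insert_subset_insert hsub h.far_mem)
        (h.far z hzF)).trans (by linarith))
    · exact .inl (h₂ z hz hzF (by simp))

/-- The result of a probe of the search with the threshold `m`. -/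
structure IsProbe (L : (ℝ × ℝ) × (ℝ × ℝ)) (o : ℝ × ℝ) (U Q : List (ℝ × ℝ)) (H m : ℝ)
    (q' : ℝ × ℝ) (G : ℝ) : Prop where
  far_mem : q' = o ∨ q' ∈ Q ∨ (q' ∈ U ∧ m ≤ sqCross L q')
  far_old : ∀ z ∈ Q, sqDist o z ≤ sqDist o q'
  far_new : ∀ z ∈ U, m ≤ sqCross L z → sqDist o z ≤ sqDist o q'
  le_err : H ≤ G
  old_le : ∀ z ∈ Q, lineDist (lineThrough o q') z ≤ G
  new_le : ∀ z ∈ U, m ≤ sqCross L z → lineDist (lineThrough o q') z ≤ G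
  err_le : G ≤ H ∨ ∃ z, (z = o ∨ z ∈ Q ∨ (z ∈ U ∧ m ≤ sqCross L z)) ∧
    sqDist o z ≤ sqDist o q' ∧ G ≤ lineDist (lineThrough o q') z

/-- The points assigned to the second line by a probe with the threshold `m`. -/
def probed (L : (ℝ × ℝ) × (ℝ × ℝ)) (F : Set (ℝ × ℝ)) (U : List (ℝ × ℝ)) (m : ℝ) :
    Set (ℝ × ℝ) :=
  F ∪ {z | z ∈ U ∧ m ≤ sqCross L z}

theorem SearchInv.mem_insert_probed (h : SearchInv S L o τ F U Q H q) {z : ℝ × ℝ}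
    (hz : z = o ∨ z ∈ Q ∨ (z ∈ U ∧ m ≤ sqCross L z)) : z ∈ insert o (probed L F U m) := by
  rcases hz with hz | hz | hz
  · exact .inl hz
  · exact (h.old z hz).imp_right .inl
  · exact .inr (.inr hz)

/-- A measured error above the old one is witnessed by a single point no farther from `o` than `q'`.
-/
theorem SearchInv.err_le_of_probe (h : SearchInv S L o τ F U Q H q)
    (hp : IsProbe L o U Q H m q' G) {b : ℝ} (hb : 0 ≤ b)
    (hF : ∀ z ∈ insert o (probed L F U m), ∀ y ∈ insert o (probed L F U m),
      sqDist o z ≤ sqDist o y → lineDist (lineThrough o y) z ≤ b) : G ≤ b := by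
  rcases hp.err_le with hG | ⟨z, hz, hd, hG⟩
  · have hs : insert o F ⊆ insert o (probed L F U m) :=
      Set.insert_subset_insert Set.subset_union_left
    exact hG.trans (h.err_le b hb fun z hz y hy => hF z (hs hz) y (hs hy))
  · exact hG.trans (hF z (h.mem_insert_probed hz) q' (h.mem_insert_probed hp.far_mem) hd)

/-- A new point was measured by the probe; an old one is reached through its representative, with
squared distance at most 2H + 2G ≤ 4G. -/
theorem SearchInv.lineDist_le_of_probe (h : SearchInv S L o τ F U Q H q)
    (hp : IsProbe L o U Q H m q' G) {z : ℝ × ℝ} (hz : z ∈ probed L F U m) :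
    lineDist (lineThrough o q') z ≤ 4 * G := by
  rcases hz with hz | ⟨hz, hm⟩
  · obtain ⟨y, hy, hd, hH⟩ := h.cover z hz
    have := lineDist_lineThrough_le (x := q') hd
    linarith [hp.le_err, hp.old_le y hy]
  · have := hp.new_le z hz hm
    linarith [lineDist_nonneg (lineThrough o q') z]

theorem SearchInv.accept (h : SearchInv S L o τ F U Q H q) (hp : IsProbe L o U Q H m q' G)
    (hm : ∃ z ∈ U, sqCross L z = m) (hL : 0 < sqLen L)
    (hG : 4 * G * sqLen L ≤ m) (hU' : ∀ z, z ∈ U' ↔ z ∈ U ∧ sqCross L z < m) :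
    SearchInv S L o τ (probed L F U m) U' (q' :: Q) G q' := by
  refine ⟨fun z hz => h.mem_of_mem z ((hU' z).1 hz).1, ?_, ?_, ?_, ?_, ?_,
    h.mem_insert_probed hp.far_mem, ?_, ?_⟩
  · exact Set.union_subset h.subset fun z hz => h.mem_of_mem z hz.1
  · rintro z hz (hzF | ⟨-, hzm⟩)
    · exact h.notMem z ((hU' z).1 hz).1 hzF
    · exact hzm.not_gt ((hU' z).1 hz).2
  · intro y hy
    rcases List.mem_cons.1 hy with rfl | hy
    · exact h.mem_insert_probed hp.far_mem
    · exact h.mem_insert_probed (.inr (.inl hy))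
  · rintro z (hz | ⟨hz, hzm⟩)
    · obtain ⟨y, hy, hd, hH⟩ := h.cover z hz
      exact ⟨y, List.mem_cons_of_mem _ hy, hd, hH.trans hp.le_err⟩
    · exact ⟨q', List.mem_cons_self, hp.far_new z hz hzm, hp.new_le z hz hzm⟩
  · exact fun b hb hF => h.err_le_of_probe hp hb hF
  · rintro z (hz | ⟨hz, hzm⟩)
    · obtain ⟨y, hy, hd, -⟩ := h.cover z hz
      exact hd.trans (hp.far_old y hy)
    · exact hp.far_new z hz hzm
  -- A cut within the bound succeeds by the acceptance test alone. A cut beyond it adds only far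
  -- points, and cannot occur after a success, since `m` is attained at an unassigned point.
  · by_cases hmτ : m ≤ τ * sqLen L
    · left
      have hGτ : 4 * G ≤ τ := le_of_mul_le_mul_right (hG.trans hmτ) hL
      refine ⟨fun z hz => (h.lineDist_le_of_probe hp hz).trans hGτ, fun z hz hzF => ?_⟩
      have hzF' : z ∉ F := fun h => hzF (.inl h)
      rcases h.main with ⟨-, h₂⟩ | ⟨-, h₂⟩
      · exact h₂ z hz hzF'
      · by_cases hzU : z ∈ U
        · exact (not_le.1 fun hzm => hzF (.inr ⟨hzU, hzm⟩)).le.trans hmτ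
        · exact h₂ z hz hzF' hzU
    · rcases h.main with ⟨h₁, h₂⟩ | ⟨h₁, h₂⟩
      · obtain ⟨z, hz, rfl⟩ := hm
        exact absurd (h₂ z (h.mem_of_mem z hz) (h.notMem z hz)) hmτ
      · right
        refine ⟨?_, fun z hz hzF hzU' => ?_⟩
        · rintro z (hz | ⟨hz, hzm⟩)
          · exact h₁ z hz
          · exact (not_le.1 hmτ).trans_le hzm
        · refine h₂ z hz (fun h => hzF (.inl h)) fun hzU => ?_
          by_cases hzm : m ≤ sqCross L z
          · exact hzF (.inr ⟨hzU, hzm⟩)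
          · exact hzU' ((hU' z).2 ⟨hzU, not_le.1 hzm⟩)

/-- A past success persists because `F` and `q` do not change. Otherwise, a cut beyond τ would have
probed only far points, with error at most β, and 4β ≤ τ would have passed the test; so only points
within τ of `L` are discarded. -/
theorem SearchInv.reject (h : SearchInv S L o τ F U Q H q) (hp : IsProbe L o U Q H m q' G)
    (hF : FarCovered S L o τ β) (hβ : 0 ≤ β) (hτ : 4 * β ≤ τ)
    (hG : ¬ 4 * G * sqLen L ≤ m) (hU' : ∀ z, z ∈ U' ↔ z ∈ U ∧ m < sqCross L z) :
    SearchInv S L o τ F U' Q H q := by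
  refine ⟨fun z hz => h.mem_of_mem z ((hU' z).1 hz).1, h.subset,
    fun z hz => h.notMem z ((hU' z).1 hz).1, h.old, h.cover, h.err_le,
    h.far_mem, h.far, h.main.imp_right fun ⟨h₁, h₂⟩ => ⟨h₁, fun z hz hzF hzU' => ?_⟩⟩
  by_cases hzU : z ∈ U
  swap
  · exact h₂ z hz hzF hzU
  by_contra hzτ
  have hzm : sqCross L z ≤ m := not_lt.1 fun hzm => hzU' ((hU' z).2 ⟨hzU, hzm⟩)
  have hmτ : τ * sqLen L < m := (not_le.1 hzτ).trans_le hzm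
  have hsub : probed L F U m ⊆ {z ∈ S | τ * sqLen L < sqCross L z} := by
    rintro y (hy | ⟨hy, hym⟩)
    · exact ⟨h.subset hy, h₁ y hy⟩
    · exact ⟨h.mem_of_mem y hy, hmτ.trans_le hym⟩
  have hGβ : G ≤ β := h.err_le_of_probe hp hβ fun z hz y hy =>
    hF z (Set.insert_subset_insert hsub hz) y (Set.insert_subset_insert hsub hy)
  refine hG (le_trans ?_ hmτ.le)
  exact mul_le_mul_of_nonneg_right (by linarith) (sqLen_nonneg L)

end TwoLineCenter

/-! ### Running time and correctness of one round of the search -/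

namespace RealProg

open TwoLineCenter

theorem exists_evalLe_median (L : (ℝ × ℝ) × (ℝ × ℝ)) {U : List (ℝ × ℝ)} (hU : U ≠ []) :
    ∃ m, (∃ z ∈ U, sqCross L z = m) ∧ 2 * (U.filter fun z => sqCross L z < m).length ≤ U.length ∧
      2 * (U.filter fun z => m < sqCross L z).length ≤ U.length ∧
      EvalLe twoLineFns [.pair (encodeLine L) (encodeList encodePoint U)] medianBody (.real m)
        (370000 * (U.length + 1)) := by
  have hpos := List.length_pos_iff.2 hU
  obtain ⟨m, ⟨h₁, h₂, h₃⟩, h₄⟩ := exists_evalLe_select _ (U.map (sqCross L)).reverse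
    ((1 / 2 : ℚ) * (U.map (sqCross L)).reverse.length) rfl
    (by rw [List.length_reverse, List.length_map]; positivity)
    (by push_cast; linarith [(Nat.cast_nonneg (U.map (sqCross L)).reverse.length : (0 : ℝ) ≤ _)])
  refine ⟨m, by simpa using h₁, ?_, ?_, ?_⟩
  · have h : U.countP (fun z => sqCross L z < m) ≤ U.length := List.countP_le_length
    rw [List.countP_reverse, List.countP_map, List.length_reverse, List.length_map] at h₂
    rw [← List.countP_eq_length_filter]
    have : 2 * (U.countP (fun z => sqCross L z < m) : ℝ) ≤ U.length := by
      push_cast at h₂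
      have h₂' : (U.countP (fun z => sqCross L z < m) : ℝ) < 1 / 2 * U.length := h₂
      linarith
    exact_mod_cast this
  · have e := countP_lt_add_le (U.map (sqCross L)) m
    rw [List.countP_reverse, List.length_reverse] at h₃
    rw [List.countP_map, List.length_map] at e
    rw [← List.countP_eq_length_filter]
    have h : U.length ≤ 2 * (U.map (sqCross L)).countP (· ≤ m) := by
      have : (U.length : ℝ) ≤ 2 * (U.map (sqCross L)).countP (· ≤ m) := by
        push_cast [List.length_map] at h₃
        linarith
      exact_mod_cast this
    have e' : U.countP (fun z => m < sqCross L z) + (U.map (sqCross L)).countP (· ≤ m) =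
      U.length := e
    omega
  · refine (EvalLe.letIn (EvalLe.call_map (l := U) 1000 encodePoint (sqCross L) (encodeLine L)
      (by decide) rfl (fun _ _ _ _ _ => run_sqCrossE rfl rfl) rfl le_rfl).sndE <|
      EvalLe.letIn (EvalLe.call_count (l := (U.map (sqCross L)).reverse) (n := U.length) 1000 .real
        (by decide) rfl ?_ (by simp)) (EvalLe.call 50 (by decide) ?_ rfl h₄)).mono ?_
    · simp [run]
    · simp [run, Op.apply]
    · simp only [List.length_reverse, List.length_map]
      omega

/-- The scanned list `E` consists of the new points and the representatives; the points assigned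
earlier are not touched, which keeps a probe cheap. -/
theorem exists_evalLe_probe (L : (ℝ × ℝ) × (ℝ × ℝ)) (o : ℝ × ℝ) (U Q : List (ℝ × ℝ)) (H m : ℝ) :
    ∃ q G, IsProbe L o U Q H m q G ∧
      EvalLe twoLineFns [.pair (.pair (.pair (encodeLine L) (.real m)) (encodePoint o))
        (.pair (.pair (encodeList encodePoint U) (encodeList encodePoint Q)) (.real H))] probeBody
        (.pair (encodePoint q) (.real G)) (4000 * (U.length + Q.length + 1)) := by
  set E := (U.filter fun z => m ≤ sqCross L z).reverse ++ Q with hE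
  have hmE : ∀ z, z ∈ E ↔ z ∈ Q ∨ (z ∈ U ∧ m ≤ sqCross L z) := by
    intro z
    simp [hE, or_comm]
  set q := argmax (sqDist o) E o with hq
  set e := argmax (sqCross (lineThrough o q)) E o with he
  have hfar := (le_argmax (sqDist o) E o).2
  have herr := (le_argmax (sqCross (lineThrough o q)) E o).2
  rw [← hq] at hfar
  rw [← he] at herr
  have hlen : E.length ≤ U.length + Q.length := by
    have := List.length_filter_le (fun z => decide (m ≤ sqCross L z)) U
    simp only [hE, List.length_append, List.length_reverse]
    omega
  have herr' : ∀ z ∈ E, lineDist (lineThrough o q) z ≤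
      max H (lineDist (lineThrough o q) e) := fun z hz =>
    le_max_of_le_right (div_le_div_of_nonneg_right (herr z hz) (sqLen_nonneg _))
  refine ⟨q, max H (lineDist (lineThrough o q) e), ⟨?_, fun z hz => hfar z ((hmE z).2 (.inl hz)),
    fun z hz hm => hfar z ((hmE z).2 (.inr ⟨hz, hm⟩)), le_max_left _ _,
    fun z hz => herr' z ((hmE z).2 (.inl hz)),
    fun z hz hm => herr' z ((hmE z).2 (.inr ⟨hz, hm⟩)), ?_⟩, ?_⟩
  · exact (argmax_mem (sqDist o) E o).imp_right (hmE _).1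
  · rcases max_choice H (lineDist (lineThrough o q) e) with h | h
    · exact .inl h.le
    · refine .inr ⟨e, ?_, ?_, h.le⟩
      · exact (argmax_mem (sqCross (lineThrough o q)) E o).imp_right (hmE _).1
      · rcases argmax_mem (sqCross (lineThrough o q)) E o with h | h
        · rw [he, h, sqDist_self]
          exact sqDist_nonneg _ _
        · exact hfar _ h
  · have hL : sqLen (lineThrough o q) ≠ 0 := (sqLen_lineThrough_pos o q).ne'
    refine (EvalLe.letIn (EvalLe.call_keep (l := U) (out := Q) 1000 encodePoint (fun _ => m)
        (sqCross L) (.pair (encodeLine L) (.real m)) (by decide) rfl (fun _ _ _ _ _ => rfl)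
        (fun _ _ _ _ _ => run_sqCrossE rfl rfl) rfl le_rfl).sndE <|
      EvalLe.letIn (EvalLe.call_argmax (l := E) (i := o) 1000 encodePoint (sqDist o) (encodePoint o)
        (by decide) rfl (fun _ _ _ _ _ => run_sqDistE rfl rfl) ?_ hlen).sndE.sndE <|
      EvalLe.letIn (EvalLe.of_run_le 200 (by decide) (run_lineThroughE (p := o) (q := q) rfl rfl)) <|
      EvalLe.letIn (EvalLe.call_argmax (l := E) (i := o) 1000 encodePoint
        (sqCross (lineThrough o q)) (encodeLine (lineThrough o q)) (by decide) rfl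
        (fun _ _ _ _ _ => run_sqCrossE rfl rfl) ?_ hlen).sndE.fstE <|
      EvalLe.of_run_le 300 (by decide) ?_).mono ?_
    · rw [sqDist_self]
      simp [run, fstE, sndE, hE]
    · rw [sqCross_lineThrough_self]
      simp [run, fstE, sndE, hE]
    · have hdiv : ∀ {env : List Val},
          env[0]? = some (.real (sqCross (lineThrough o q) e)) →
          env[1]? = some (encodeLine (lineThrough o q)) →
          run env (.op .div (.var 0) (sqLenE (.var 1))) =
            some (.real (lineDist (lineThrough o q) e)) := by
        intro env h₀ h₁
        simp [run, h₀, run_sqLenE (P := .var 1) (show run env (.var 1) = _ from h₁), Op.apply, hL,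
          lineDist]
      simp only [run]
      rw [run_maxE (x := H) rfl (hdiv rfl rfl)]
      rfl
    · omega

end RealProg

/-! ### The whole search in linear time -/

namespace RealProg

open TwoLineCenter

/-- The argument of `searchBody`. -/
def encodeSearch (L : (ℝ × ℝ) × (ℝ × ℝ)) (o : ℝ × ℝ) (U Q : List (ℝ × ℝ)) (H : ℝ) (q : ℝ × ℝ) :
    Val :=
  .pair (.pair (encodeLine L) (encodePoint o)) (.pair (encodeList encodePoint U)
    (.pair (encodeList encodePoint Q) (.pair (.real H) (encodePoint q))))

/-- The bounds `τ`, `β` and the set `F` are quantified after `q'`: the search knows none of them,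
and one run serves all. -/
theorem exists_evalLe_search {L : (ℝ × ℝ) × (ℝ × ℝ)} (hL : 0 < sqLen L) (o : ℝ × ℝ) (n : ℕ) :
    ∀ (U Q : List (ℝ × ℝ)) (H : ℝ) (q : ℝ × ℝ), U.length = n →
      ∃ q', EvalLe twoLineFns [encodeSearch L o U Q H q] searchBody (encodePoint q')
          (1000000 * (n * Q.length + 4 * n + 1)) ∧
        ∀ (S : Set (ℝ × ℝ)) (τ β : ℝ) (F : Set (ℝ × ℝ)), SearchInv S L o τ F U Q H q →
          FarCovered S L o τ β → 0 ≤ β → 4 * β ≤ τ →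
          ∀ z ∈ S, sqCross L z ≤ τ * sqLen L ∨ lineDist (lineThrough o q') z ≤ τ := by
  induction n using Nat.strong_induction_on with
  | _ n ih =>
  intro U Q H q hn
  rcases hU : U with _ | ⟨x, U₀⟩
  · subst hU
    refine ⟨q, ?_, fun S τ β F h hF hβ hτ => h.final hF hβ hτ⟩
    exact (EvalLe.cases_nil 50 (by decide) rfl (.of_run_le 50 (by decide)
      (by simp [run, sndE, encodeSearch]))).mono (by omega)
  have hU₀ : U ≠ [] := by simp [hU]
  have hpos : 0 < n := hn ▸ List.length_pos_iff.2 hU₀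
  rw [← hU]
  -- The `match` extracts the branch of `searchBody` for a nonempty list.
  have key : ∀ {v : Val} {B : ℕ}, EvalLe twoLineFns
      [encodePoint x, encodeList encodePoint U₀, encodeSearch L o U Q H q]
      (match searchBody with | .cases _ _ e => e | e => e) v B →
      EvalLe twoLineFns [encodeSearch L o U Q H q] searchBody v (50 + B) := fun h =>
    EvalLe.cases_pair 50 (by decide) (by simp [run, fstE, sndE, encodeSearch, hU, encodeList]) h
  obtain ⟨m, hm, hm₁, hm₂, hmed⟩ := exists_evalLe_median L hU₀
  obtain ⟨q₁, G, hp, hprobe⟩ := exists_evalLe_probe L o U Q H m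
  have hprod : ∀ n' : ℕ, 2 * n' ≤ n → 2 * (n' * Q.length) ≤ n * Q.length := fun n' h => by
    rw [← mul_assoc]
    exact Nat.mul_le_mul_right _ h
  -- With a point still unassigned, the scan of `Q` is charged to the product term.
  have hnQ : Q.length ≤ n * Q.length := Nat.le_mul_of_pos_left _ hpos
  have htest : ∀ r₁ r₂ : Val, run [.pair (encodePoint q₁) (.real G), .real m, r₁, r₂,
      encodeSearch L o U Q H q] (.op .mul (.op .mul (.const 4) (sndE (.var 0)))
        (sqLenE (fstE (fstE (.var 4))))) = some (.real (4 * G * sqLen L)) := by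
    intro r₁ r₂
    simp only [run]
    rw [run_sqLenE (L := L) rfl]
    simp [sndE, run, Op.apply]
  by_cases hG : 4 * G * sqLen L ≤ m
  · set U' := (U.filter fun z => sqCross L z < m).reverse with hU'
    have hlen : 2 * U'.length ≤ n := by rw [hU', List.length_reverse, ← hn]; exact hm₁
    obtain ⟨q', h₁, h₂⟩ := ih U'.length (by omega) U' (q₁ :: Q) G q₁ rfl
    refine ⟨q', ?_, fun S τ β F h hF hβ hτ => h₂ S τ β _
      (h.accept hp hm hL hG (U' := U') fun z => by simp [hU']) hF hβ hτ⟩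
    refine (key <| EvalLe.letIn (EvalLe.call 50 (by decide) rfl rfl hmed) <|
      EvalLe.letIn (EvalLe.call 100 (by decide) rfl rfl hprobe) <|
      EvalLe.ifLe 200 (by decide) (htest _ _) rfl (fun _ => ?_)
        (fun h => absurd hG h)).mono (B₁ := 50 + (50 + 370000 * (U.length + 1) +
          (100 + 4000 * (U.length + Q.length + 1) + (200 + (1000 * (U.length + 1) + 2 + (100 +
          1000000 * (U'.length * (q₁ :: Q).length + 4 * U'.length + 1)) + 1)) + 1) + 1)) ?_
    · refine EvalLe.letIn (EvalLe.call_drop (l := U) (out := []) 1000 encodePoint (fun _ => m)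
        (sqCross L) (.pair (encodeLine L) (.real m)) (by decide) rfl (fun _ _ _ _ _ => rfl)
        (fun _ _ _ _ _ => run_sqCrossE rfl rfl) rfl le_rfl).sndE ?_
      rw [List.append_nil]
      exact EvalLe.call 100 (by decide) rfl rfl h₁
    · have := hprod _ hlen
      -- The new representative costs at most n/2 more, paid by the halving of the term 4n.
      have e : U'.length * (Q.length + 1) = U'.length * Q.length + U'.length := Nat.mul_succ _ _
      rw [List.length_cons]
      omega
  · set U' := (U.filter fun z => m < sqCross L z).reverse with hU'
    have hlen : 2 * U'.length ≤ n := by rw [hU', List.length_reverse, ← hn]; exact hm₂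
    obtain ⟨q', h₁, h₂⟩ := ih U'.length (by omega) U' Q H q rfl
    refine ⟨q', ?_, fun S τ β F h hF hβ hτ => h₂ S τ β _
      (h.reject hp hF hβ hτ hG (U' := U') fun z => by simp [hU']) hF hβ hτ⟩
    refine (key <| EvalLe.letIn (EvalLe.call 50 (by decide) rfl rfl hmed) <|
      EvalLe.letIn (EvalLe.call 100 (by decide) rfl rfl hprobe) <|
      EvalLe.ifLe 200 (by decide) (htest _ _) rfl (fun h => absurd h hG)
        (fun _ => ?_)).mono (B₁ := 50 + (50 + 370000 * (U.length + 1) +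
          (100 + 4000 * (U.length + Q.length + 1) + (200 + (1000 * (U.length + 1) + 2 + (100 +
          1000000 * (U'.length * Q.length + 4 * U'.length + 1)) + 1)) + 1) + 1)) ?_
    · refine EvalLe.letIn (EvalLe.call_drop (l := U) (out := []) 1000 encodePoint (sqCross L)
        (fun _ => m) (.pair (encodeLine L) (.real m)) (by decide) rfl
        (fun _ _ _ _ _ => run_sqCrossE rfl rfl) (fun _ _ _ _ _ => rfl) rfl le_rfl).sndE ?_
      rw [List.append_nil]
      exact EvalLe.call 100 (by decide) rfl rfl h₁
    · have := hprod _ hlen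
      omega

end RealProg

namespace TwoLineCenter

/-! ### Slabs around two lines -/

/-- The slab around the line `L` of half-width `k`, up to normalisation. -/
def slabAround (L : (ℝ × ℝ) × (ℝ × ℝ)) (hL : 0 < sqLen L) (k : ℝ) (hk : 0 ≤ k) : Slab where
  a := 0 - L.2.2
  b := L.2.1
  lo := L.2.1 * L.1.2 - L.2.2 * L.1.1 - k
  hi := L.2.1 * L.1.2 - L.2.2 * L.1.1 + k
  normal_ne_zero := by
    by_contra! h
    simp [sqLen, h.2, sub_eq_zero.1 h.1 |>.symm] at hL
  lo_le_hi := by linarith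

theorem mem_slabAround {L : (ℝ × ℝ) × (ℝ × ℝ)} {hL : 0 < sqLen L} {k : ℝ} {hk : 0 ≤ k}
    {z : ℝ × ℝ} (h : |cross L z| ≤ k) : z ∈ (slabAround L hL k hk).region := by
  obtain ⟨h₁, h₂⟩ := abs_le.1 h
  simp only [cross] at h₁ h₂
  constructor <;> simp only [slabAround] <;> linarith

theorem width_slabAround_sq {L : (ℝ × ℝ) × (ℝ × ℝ)} (hL : 0 < sqLen L) {k : ℝ} (hk : 0 ≤ k) :
    (slabAround L hL k hk).width ^ 2 = 4 * (k * k / sqLen L) := by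
  have : sqLen L = (0 - L.2.2) ^ 2 + L.2.1 ^ 2 := by
    simp only [sqLen]
    ring
  simp only [Slab.width, slabAround]
  rw [div_pow, Real.sq_sqrt (this ▸ hL.le), ← this]
  ring

/-- One step of the assignment of points to the nearer of two lines. -/
noncomputable def assign (L₁ L₂ : (ℝ × ℝ) × (ℝ × ℝ)) (k : ℝ × ℝ) (z : ℝ × ℝ) : ℝ × ℝ :=
  if |cross L₁ z| * |cross L₁ z| * sqLen L₂ ≤ |cross L₂ z| * |cross L₂ z| * sqLen L₁ then
    (max k.1 |cross L₁ z|, k.2) else (k.1, max k.2 |cross L₂ z|)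

section assign

variable {L₁ L₂ : (ℝ × ℝ) × (ℝ × ℝ)}

theorem le_foldl_assign (l : List (ℝ × ℝ)) (k : ℝ × ℝ) :
    k.1 ≤ (l.foldl (assign L₁ L₂) k).1 ∧ k.2 ≤ (l.foldl (assign L₁ L₂) k).2 := by
  induction l generalizing k with
  | nil => simp
  | cons z l ih =>
    obtain ⟨h₁, h₂⟩ := ih (assign L₁ L₂ k z)
    refine ⟨le_trans ?_ h₁, le_trans ?_ h₂⟩ <;> unfold assign <;> split_ifs <;> simp

theorem abs_cross_le_foldl_assign (l : List (ℝ × ℝ)) (k : ℝ × ℝ) : ∀ z ∈ l,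
    |cross L₁ z| ≤ (l.foldl (assign L₁ L₂) k).1 ∨ |cross L₂ z| ≤ (l.foldl (assign L₁ L₂) k).2 := by
  induction l generalizing k with
  | nil => simp
  | cons y l ih =>
    intro z hz
    rcases List.mem_cons.1 hz with rfl | hz
    · obtain ⟨h₁, h₂⟩ := le_foldl_assign (L₁ := L₁) (L₂ := L₂) l (assign L₁ L₂ k z)
      by_cases h : |cross L₁ z| * |cross L₁ z| * sqLen L₂ ≤ |cross L₂ z| * |cross L₂ z| * sqLen L₁
      · refine .inl (le_trans ?_ h₁)
        rw [assign, if_pos h]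
        exact le_max_right _ _
      · refine .inr (le_trans ?_ h₂)
        rw [assign, if_neg h]
        exact le_max_right _ _
    · exact ih _ z hz

/-- The test in `assign` compares the two squared distances after cross-multiplication, so a point
within the bound of some line is sent to a line within the bound. -/
theorem foldl_assign_sq_le (h₁ : 0 < sqLen L₁) (h₂ : 0 < sqLen L₂) {τ : ℝ} (l : List (ℝ × ℝ))
    (hl : ∀ z ∈ l, lineDist L₁ z ≤ τ ∨ lineDist L₂ z ≤ τ) (k : ℝ × ℝ)
    (hk₁ : k.1 * k.1 / sqLen L₁ ≤ τ) (hk₂ : k.2 * k.2 / sqLen L₂ ≤ τ) :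
    (l.foldl (assign L₁ L₂) k).1 * (l.foldl (assign L₁ L₂) k).1 / sqLen L₁ ≤ τ ∧
      (l.foldl (assign L₁ L₂) k).2 * (l.foldl (assign L₁ L₂) k).2 / sqLen L₂ ≤ τ := by
  induction l generalizing k with
  | nil => exact ⟨hk₁, hk₂⟩
  | cons z l ih =>
    have hz := hl z List.mem_cons_self
    have hd : ∀ L, |cross L z| * |cross L z| / sqLen L = lineDist L z := fun L => by
      rw [abs_mul_abs_self]
      rfl
    have hiff : |cross L₁ z| * |cross L₁ z| * sqLen L₂ ≤ |cross L₂ z| * |cross L₂ z| * sqLen L₁ ↔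
        lineDist L₁ z ≤ lineDist L₂ z := by
      rw [← hd, ← hd, div_le_div_iff₀ h₁ h₂]
    refine ih (fun z hz => hl z (List.mem_cons_of_mem _ hz)) _ ?_ ?_ <;> unfold assign <;>
      split_ifs with h <;> rw [hiff] at h <;> dsimp only
    · rcases max_choice k.1 |cross L₁ z| with e | e <;> rw [e]
      · exact hk₁
      · rw [hd]
        exact hz.elim id h.trans
    · exact hk₁
    · exact hk₂
    · rcases max_choice k.2 |cross L₂ z| with e | e <;> rw [e]
      · exact hk₂
      · rw [hd]
        exact hz.elim (not_le.1 h).le.trans id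

end assign

/-- Two slabs that cover the points of `l` and whose widths are at most `2 * √x`. -/
structure IsSolution (l : List (ℝ × ℝ)) (x : ℝ) (σ₁ σ₂ : Slab) : Prop where
  covers : Covers σ₁ σ₂ {z | z ∈ l}
  width_sq₁ : σ₁.width ^ 2 ≤ 4 * x
  width_sq₂ : σ₂.width ^ 2 ≤ 4 * x

end TwoLineCenter

namespace RealProg

open TwoLineCenter

variable {env : List Val}

theorem run_slabE {P K : Expr} {L : (ℝ × ℝ) × (ℝ × ℝ)} {k : ℝ} (hL : 0 < sqLen L) (hk : 0 ≤ k)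
    (hP : run env P = some (encodeLine L)) (hK : run env K = some (.real k)) :
    run env (slabE P K) = some (encodeSlab (slabAround L hL k hk)) := by
  simp [slabE, run, fstE, sndE, hP, hK, encodePoint, encodeLine, Op.apply, encodeSlab, slabAround]

theorem run_absE {P : Expr} {x : ℝ} (h : run env P = some (.real x)) :
    run env (maxE P (.op .sub (.const 0) P)) = some (.real |x|) := by
  rw [run_maxE (y := 0 - x) h (by simp [run, h, Op.apply]), zero_sub, abs_eq_max_neg]

/-- A solution, after the square of half of its width. -/
def encodeSolution (x : ℝ) (σ₁ σ₂ : Slab) : Val := .pair (.real x) (encodeSlabs σ₁ σ₂)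

theorem exists_evalLe_slabs {L₁ L₂ : (ℝ × ℝ) × (ℝ × ℝ)} (h₁ : 0 < sqLen L₁) (h₂ : 0 < sqLen L₂)
    (l : List (ℝ × ℝ)) :
    ∃ x σ₁ σ₂, IsSolution l x σ₁ σ₂ ∧
      (∀ τ, 0 ≤ τ → (∀ z ∈ l, lineDist L₁ z ≤ τ ∨ lineDist L₂ z ≤ τ) → x ≤ τ) ∧
      EvalLe twoLineFns [.pair (.pair (encodeLine L₁) (encodeLine L₂)) (encodeList encodePoint l)]
        slabsBody (encodeSolution x σ₁ σ₂) (6000 * (l.length + 1)) := by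
  set k := l.foldl (assign L₁ L₂) (0, 0) with hk
  obtain ⟨k₁, k₂⟩ : 0 ≤ k.1 ∧ 0 ≤ k.2 := le_foldl_assign l (0, 0)
  refine ⟨max (k.1 * k.1 / sqLen L₁) (k.2 * k.2 / sqLen L₂), slabAround L₁ h₁ k.1 k₁,
    slabAround L₂ h₂ k.2 k₂, ⟨?_, ?_, ?_⟩, ?_, ?_⟩
  · exact fun z hz =>
      (abs_cross_le_foldl_assign l (0, 0) z hz).imp mem_slabAround mem_slabAround
  · rw [width_slabAround_sq]
    gcongr
    exact le_max_left _ _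
  · rw [width_slabAround_sq]
    gcongr
    exact le_max_right _ _
  · intro τ hτ hl
    exact max_le_iff.2 (foldl_assign_sq_le h₁ h₂ l hl (0, 0) (by simpa) (by simpa))
  · have hL₁ := h₁.ne'
    have hL₂ := h₂.ne'
    refine (EvalLe.letIn (EvalLe.call_fold (l := l) (b := ((0, 0) : ℝ × ℝ)) 5000 encodePoint
      (fun k => .pair (.pair (encodeLine L₁) (encodeLine L₂)) (.pair (.real k.1) (.real k.2)))
      (assign L₁ L₂) (by decide) rfl ?_ ?_ le_rfl).sndE <|
      EvalLe.pair (EvalLe.of_run_le 400 (by decide) (run_maxE ?_ ?_)) <|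
      EvalLe.pair (EvalLe.of_run_le 200 (by decide) (run_slabE h₁ k₁ rfl rfl))
        (EvalLe.of_run_le 200 (by decide) (run_slabE h₂ k₂ rfl rfl))).mono ?_
    · intro k z r₁ r₂ r₃
      simp only [assignStep, run]
      rw [run_absE (run_crossE (L := L₁) (q := z) rfl rfl)]
      dsimp only
      rw [run_absE (run_crossE (L := L₂) (q := z) rfl rfl)]
      dsimp only
      rw [run_sqLenE (L := L₂) rfl, run_sqLenE (L := L₁) rfl,
        run_maxE (x := k.1) (y := |cross L₁ z|) rfl rfl,
        run_maxE (x := k.2) (y := |cross L₂ z|) rfl rfl]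
      simp only [assign, List.getElem?_cons_zero, List.getElem?_cons_succ, Op.apply, Option.map_some,
        fstE, sndE, run]
      split_ifs <;> rfl
    · simp [run, fstE, sndE]
    · simp only [run]
      rw [run_sqLenE (L := L₁) rfl]
      simp [run, fstE, Op.apply, hL₁]
      rfl
    · simp only [run]
      rw [run_sqLenE (L := L₂) rfl]
      simp [run, sndE, Op.apply, hL₂]
      rfl
    · omega

end RealProg

/-! ### Anchor pairs and the analysis of the candidates -/

namespace TwoLineCenter

theorem sqDist_comm (p q : ℝ × ℝ) : sqDist p q = sqDist q p := by
  simp only [sqDist]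
  ring

theorem sqDist_le (x y z : ℝ × ℝ) : sqDist x z ≤ 2 * sqDist y x + 2 * sqDist y z := by
  simp only [sqDist]
  linarith [mul_self_nonneg (x.1 + z.1 - 2 * y.1), mul_self_nonneg (x.2 + z.2 - 2 * y.2)]

theorem Slab.width_nonneg (σ : Slab) : 0 ≤ σ.width :=
  div_nonneg (sub_nonneg.2 σ.lo_le_hi) (Real.sqrt_nonneg _)

theorem Covers.symm {σ₁ σ₂ : Slab} {S : Set (ℝ × ℝ)} (h : Covers σ₁ σ₂ S) : Covers σ₂ σ₁ S :=
  fun _ hz => (h hz).symm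

/-- The number `x` is at most `25 w ^ 2` if `u` and `v` form an anchor pair of one of two slabs of
width at most `w` that cover the points of `l`. -/
def AnchorBound (l : List (ℝ × ℝ)) (u v : ℝ × ℝ) (x : ℝ) : Prop :=
  ∀ (w : ℝ) (σ σ' : Slab), Covers σ σ' {z | z ∈ l} → σ.width ≤ w → σ'.width ≤ w →
    u ∈ σ.region → v ∈ σ.region → (∀ z ∈ l, sqDist u z ≤ 16 * sqDist u v) → x ≤ 25 * w ^ 2

theorem AnchorBound.mono {l : List (ℝ × ℝ)} {u v : ℝ × ℝ} {x y : ℝ} (h : AnchorBound l u v x)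
    (hy : y ≤ x) : AnchorBound l u v y :=
  fun w σ σ' h₁ h₂ h₃ h₄ h₅ h₆ => hy.trans (h w σ σ' h₁ h₂ h₃ h₄ h₅ h₆)

theorem farCovered_of_anchor {l : List (ℝ × ℝ)} {u v : ℝ × ℝ} {w : ℝ} {σ σ' : Slab}
    (hc : Covers σ σ' {z | z ∈ l}) (hw : σ.width ≤ w) (hw' : σ'.width ≤ w)
    (hu : u ∈ σ.region) (hv : v ∈ σ.region) (huv : ∀ z ∈ l, sqDist u z ≤ 16 * sqDist u v)
    {o : ℝ × ℝ} (ho : o = u ∨ o ∈ l)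
    (hmax : ∀ z ∈ l, sqCross (lineThrough u v) z ≤ sqCross (lineThrough u v) o) :
    FarCovered {z | z ∈ l} (lineThrough u v) o (25 * w ^ 2) (4 * w ^ 2) := by
  have hlen := sqLen_lineThrough_pos u v
  -- With κ = 4, input points of `σ` are within 5w of the anchor line, so far points must lie in
  -- `σ'`.
  have hfar : ∀ z, z = u ∨ z ∈ l →
      25 * w ^ 2 * sqLen (lineThrough u v) < sqCross (lineThrough u v) z → z ∈ σ'.region := by
    intro z hz hlt
    rcases hz with rfl | hz
    · rw [sqCross_lineThrough_self] at hlt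
      exact absurd hlt (not_lt.2 (by positivity))
    · refine (hc hz).resolve_left fun hzσ => hlt.not_ge ?_
      have := lineDist_le_of_mem_slab (κ := 4) hw (by norm_num) hu hv hzσ
        ((huv z hz).trans (by norm_num))
      rw [← div_le_iff₀ hlen]
      exact this.trans (by linarith)
  intro z hz y hy hzy
  by_cases hoσ : o ∈ σ'.region
  · have hin : ∀ x ∈ insert o {z | z ∈ {z | z ∈ l} ∧
        25 * w ^ 2 * sqLen (lineThrough u v) < sqCross (lineThrough u v) z}, x ∈ σ'.region := by
      rintro x (rfl | ⟨hx, hlt⟩)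
      · exact hoσ
      · exact hfar x (.inr hx) hlt
    have := lineDist_le_of_mem_slab (κ := 1) hw' zero_le_one hoσ (hin y hy) (hin z hz) (by simpa)
    exact this.trans (by linarith)
  -- If `o` is outside `σ'` it is not far, and being farthest from the line it leaves no far points
  -- at all.
  · have hzo : z = o := hz.resolve_right fun ⟨hzl, hlt⟩ =>
      hoσ (hfar o ho (hlt.trans_le (hmax z hzl)))
    rw [hzo, lineDist_lineThrough_self]
    positivity

/-- One of the candidates of the algorithm is good. -/
theorem le_of_candidates {l A B : List (ℝ × ℝ)} {p q a a' b b' : ℝ × ℝ} {x w : ℝ} {σ₁ σ₂ : Slab}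
    (hc : Covers σ₁ σ₂ {z | z ∈ l}) (hw₁ : σ₁.width ≤ w) (hw₂ : σ₂.width ≤ w)
    (hp : p ∈ l) (hq : q ∈ l) (hfar : ∀ z ∈ l, sqDist p z ≤ sqDist p q)
    (hA : ∀ z, z ∈ A ↔ z ∈ l ∧ sqDist p z ≤ sqDist q z)
    (hB : ∀ z, z ∈ B ↔ z ∈ l ∧ sqDist q z < sqDist p z)
    (ha : a = p ∨ a ∈ A) (ha' : a' = p ∨ a' ∈ A) (hb : b = q ∨ b ∈ B) (hb' : b' = q ∨ b' ∈ B)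
    (hafar : ∀ z ∈ A, sqDist p z ≤ sqDist p a) (hbfar : ∀ z ∈ B, sqDist q z ≤ sqDist q b)
    (hamax : ∀ z ∈ A, sqCross (lineThrough p a) z ≤ sqCross (lineThrough p a) a')
    (hbmax : ∀ z ∈ B, sqCross (lineThrough q b) z ≤ sqCross (lineThrough q b) b')
    (hx : ∀ τ, 0 ≤ τ →
      (∀ z ∈ l, lineDist (lineThrough p a) z ≤ τ ∨ lineDist (lineThrough q b) z ≤ τ) → x ≤ τ)
    (h₁ : AnchorBound l p q x) (h₂ : AnchorBound l q a x) (h₃ : AnchorBound l q a' x)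
    (h₄ : AnchorBound l p b x) (h₅ : AnchorBound l p b' x) : x ≤ 25 * w ^ 2 := by
  wlog hpσ : p ∈ σ₁.region generalizing σ₁ σ₂
  · exact this hc.symm hw₂ hw₁ ((hc hp).resolve_left hpσ)
  have hw : 0 ≤ w := σ₁.width_nonneg.trans hw₁
  have hAp : ∀ z, z = p ∨ z ∈ A → z ∈ l ∧ sqDist p z ≤ sqDist q z := by
    rintro z (rfl | hz)
    · exact ⟨hp, by rw [sqDist_self]; exact sqDist_nonneg _ _⟩
    · exact (hA z).1 hz
  have hBq : ∀ z, z = q ∨ z ∈ B → z ∈ l ∧ sqDist q z ≤ sqDist p z := by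
    rintro z (rfl | hz)
    · exact ⟨hq, by rw [sqDist_self]; exact sqDist_nonneg _ _⟩
    · exact ((hB z).1 hz).imp_right le_of_lt
  by_cases hqσ : q ∈ σ₁.region
  · exact h₁ w σ₁ σ₂ hc hw₁ hw₂ hpσ hqσ fun z hz => by
      linarith [hfar z hz, sqDist_nonneg p q]
  have hqσ₂ : q ∈ σ₂.region := (hc hq).resolve_left hqσ
  -- The factor 16 arises as 4 · 4: |qz|² ≤ 4|pq|² since `q` is farthest from `p`, and |pq|² ≤
  -- 4|qa|² since `a` is nearer to `p`.
  have hqa : ∀ a, a = p ∨ a ∈ A → AnchorBound l q a x → x ≤ 25 * w ^ 2 ∨ a ∈ σ₁.region := by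
    intro a ha h
    obtain ⟨hal, had⟩ := hAp a ha
    refine or_iff_not_imp_right.2 fun haσ => ?_
    refine h w σ₂ σ₁ hc.symm hw₂ hw₁ hqσ₂ ((hc hal).resolve_left haσ) fun z hz => ?_
    have e₁ := sqDist_le q p z
    have e₂ := sqDist_le p a q
    rw [sqDist_comm a p, sqDist_comm a q] at e₂
    linarith [hfar z hz]
  have hpb : ∀ b, b = q ∨ b ∈ B → AnchorBound l p b x → x ≤ 25 * w ^ 2 ∨ b ∈ σ₂.region := by
    intro b hb h
    obtain ⟨hbl, hbd⟩ := hBq b hb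
    refine or_iff_not_imp_right.2 fun hbσ => ?_
    refine h w σ₁ σ₂ hc hw₁ hw₂ hpσ ((hc hbl).resolve_right hbσ) fun z hz => ?_
    have e₂ := sqDist_le p b q
    rw [sqDist_comm b p, sqDist_comm b q] at e₂
    linarith [hfar z hz, sqDist_nonneg p b]
  rcases hqa a ha h₂ with h | haσ
  · exact h
  rcases hqa a' ha' h₃ with h | haσ'
  · exact h
  rcases hpb b hb h₄ with h | hbσ
  · exact h
  rcases hpb b' hb' h₅ with h | hbσ'
  · exact h
  -- Only `o`, `c`, `c'` need to share a slab: `c'` is the worst point of `D` for the line oc, so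
  -- the other points may lie in either slab.
  have hcl : ∀ {o c c' : ℝ × ℝ} {D : List (ℝ × ℝ)} {σ : Slab}, σ.width ≤ w → o ∈ σ.region →
      c ∈ σ.region → c' ∈ σ.region → c' = o ∨ c' ∈ D → (∀ z ∈ D, sqDist o z ≤ sqDist o c) →
      (∀ z ∈ D, sqCross (lineThrough o c) z ≤ sqCross (lineThrough o c) c') →
      ∀ z ∈ D, lineDist (lineThrough o c) z ≤ 25 * w ^ 2 := by
    intro o c c' D σ hσ ho hc hc' hcD hfar hmax z hz
    have hd : sqDist o c' ≤ 1 ^ 2 * sqDist o c := by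
      rw [one_pow, one_mul]
      rcases hcD with rfl | hcD
      · rw [sqDist_self]
        exact sqDist_nonneg _ _
      · exact hfar _ hcD
    calc lineDist (lineThrough o c) z ≤ lineDist (lineThrough o c) c' :=
          div_le_div_of_nonneg_right (hmax z hz) (sqLen_nonneg _)
      _ ≤ ((1 + 1) * w) ^ 2 := lineDist_le_of_mem_slab hσ zero_le_one ho hc hc' hd
      _ ≤ 25 * w ^ 2 := by nlinarith [sq_nonneg w]
  refine hx _ (by positivity) fun z hz => ?_
  by_cases hzA : sqDist p z ≤ sqDist q z
  · exact .inl (hcl hw₁ hpσ haσ haσ' ha' hafar hamax z ((hA z).2 ⟨hz, hzA⟩))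
  · exact .inr (hcl hw₂ hqσ₂ hbσ hbσ' hb' hbfar hbmax z ((hB z).2 ⟨hz, not_le.1 hzA⟩))

end TwoLineCenter

/-! ### Evaluation of the candidates and of the main expression -/

namespace RealProg

open TwoLineCenter

theorem exists_evalLe_anchor (l : List (ℝ × ℝ)) (u v : ℝ × ℝ) :
    ∃ x σ₁ σ₂, IsSolution l x σ₁ σ₂ ∧ AnchorBound l u v x ∧
      EvalLe twoLineFns [.pair (.pair (encodePoint u) (encodePoint v)) (encodeList encodePoint l)]
        anchorBody (encodeSolution x σ₁ σ₂) (5000000 * (l.length + 1)) := by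
  set L := lineThrough u v with hL
  have hlen : 0 < sqLen L := sqLen_lineThrough_pos u v
  set o := argmax (sqCross L) l u with ho
  obtain ⟨q, hq, hspec⟩ := exists_evalLe_search hlen o l.length l [] 0 o rfl
  obtain ⟨x, σ₁, σ₂, hsol, hx, hev⟩ := exists_evalLe_slabs hlen (sqLen_lineThrough_pos o q) l
  refine ⟨x, σ₁, σ₂, hsol, ?_, ?_⟩
  · intro w σ σ' hc hw hw' hu hv huv
    refine hx _ (by positivity) fun z hz => ?_
    rw [lineDist, div_le_iff₀ hlen]
    exact hspec {z | z ∈ l} (25 * w ^ 2) (4 * w ^ 2) ∅ (SearchInv.init fun z => Iff.rfl)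
      (farCovered_of_anchor hc hw hw' hu hv huv (argmax_mem _ _ _) (le_argmax _ _ _).2)
      (by positivity) (by linarith [sq_nonneg w]) z hz
  · refine (EvalLe.letIn (EvalLe.of_run_le 200 (by decide) (run_lineThroughE rfl rfl)) <|
      EvalLe.letIn (EvalLe.call_argmax (l := l) (i := u) 1000 encodePoint (sqCross L)
        (encodeLine L) (by decide) rfl (fun _ _ _ _ _ => run_sqCrossE rfl rfl) ?_
        le_rfl).sndE.sndE <|
      EvalLe.letIn (EvalLe.call 100 (by decide) ?_ rfl hq) <|
      EvalLe.call 300 (by decide) ?_ rfl hev).mono ?_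
    · rw [hL, sqCross_lineThrough_self]
      simp [run, fstE, sndE]
    · simp [run, sndE, encodeSearch, encodeList]
      exact ⟨rfl, rfl⟩
    · simp only [run]
      rw [run_lineThroughE (p := o) (q := q) rfl rfl]
      rfl
    · simp only [List.length_nil]
      omega

theorem evalLe_cluster (o : ℝ × ℝ) (A : List (ℝ × ℝ)) {n : ℕ} (hn : A.length ≤ n) :
    EvalLe twoLineFns [.pair (encodePoint o) (encodeList encodePoint A)] clusterBody
      (.pair (encodeLine (lineThrough o (argmax (sqDist o) A o)))
        (.pair (encodePoint (argmax (sqDist o) A o))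
          (encodePoint (argmax (sqCross (lineThrough o (argmax (sqDist o) A o))) A o))))
      (3000 * (n + 1)) := by
  refine (EvalLe.letIn (EvalLe.call_argmax (l := A) (i := o) 1000 encodePoint (sqDist o)
      (encodePoint o) (by decide) rfl (fun _ _ _ _ _ => run_sqDistE rfl rfl) ?_ hn).sndE.sndE <|
    EvalLe.letIn (EvalLe.of_run_le 200 (by decide) (run_lineThroughE rfl rfl)) <|
    EvalLe.letIn (EvalLe.call_argmax (l := A) (i := o) 1000 encodePoint (sqCross _) (encodeLine _)
      (by decide) rfl (fun _ _ _ _ _ => run_sqCrossE rfl rfl) ?_ hn).sndE.sndE <|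
    EvalLe.of_run_le 50 (by decide) rfl).mono ?_
  · rw [sqDist_self]
    simp [run, fstE, sndE]
  · rw [sqCross_lineThrough_self]
    simp [run, fstE, sndE]
  · omega

theorem exists_evalLe_improve {l : List (ℝ × ℝ)} {x : ℝ} {σ₁ σ₂ : Slab}
    (h : IsSolution l x σ₁ σ₂) (u v : ℝ × ℝ) :
    ∃ y τ₁ τ₂, IsSolution l y τ₁ τ₂ ∧ y ≤ x ∧ AnchorBound l u v y ∧
      EvalLe twoLineFns [.pair (encodeSolution x σ₁ σ₂)
        (.pair (.pair (encodePoint u) (encodePoint v)) (encodeList encodePoint l))]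
        improveBody (encodeSolution y τ₁ τ₂) (5000000 * (l.length + 1) + 200) := by
  obtain ⟨y, τ₁, τ₂, hy, hb, hev⟩ := exists_evalLe_anchor l u v
  have hlet : ∀ {w : Val}, EvalLe twoLineFns [encodeSolution y τ₁ τ₂,
      .pair (encodeSolution x σ₁ σ₂)
        (.pair (.pair (encodePoint u) (encodePoint v)) (encodeList encodePoint l))]
      (.ifLe (fstE (fstE (.var 1))) (fstE (.var 0)) (fstE (.var 1)) (.var 0)) w 100 →
      EvalLe twoLineFns [.pair (encodeSolution x σ₁ σ₂)
        (.pair (.pair (encodePoint u) (encodePoint v)) (encodeList encodePoint l))]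
        improveBody w (5000000 * (l.length + 1) + 200) := fun h =>
    (EvalLe.letIn (EvalLe.call 50 (by decide) rfl rfl hev) h).mono (by omega)
  by_cases hxy : x ≤ y
  · exact ⟨x, σ₁, σ₂, h, le_rfl, hb.mono hxy, hlet (.ifLe 50 (by decide) rfl rfl
      (fun _ => .of_run_le 50 (by decide) rfl) fun h => absurd hxy h)⟩
  · exact ⟨y, τ₁, τ₂, hy, (not_le.1 hxy).le, hb, hlet (.ifLe 50 (by decide) rfl rfl
      (fun h => absurd h hxy) fun _ => .of_run_le 50 (by decide) rfl)⟩

theorem exists_evalLe_main (l : List (ℝ × ℝ)) (hl : l ≠ []) :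
    ∃ x σ₁ σ₂, IsSolution l x σ₁ σ₂ ∧
      (∀ (w : ℝ) (τ₁ τ₂ : Slab), Covers τ₁ τ₂ {z | z ∈ l} → τ₁.width ≤ w → τ₂.width ≤ w →
        x ≤ 25 * w ^ 2) ∧
      EvalLe twoLineFns [encodePoints l] twoLineMain (encodeSlabs σ₁ σ₂)
        (30000000 * (l.length + 1)) := by
  obtain ⟨p, hhead, hp⟩ : ∃ p, (∀ env : List Val, env[0]? = some (encodeList encodePoint l) →
      run env (fstE (.var 0)) = some (encodePoint p)) ∧ p ∈ l := by
    obtain ⟨p, l', rfl⟩ := List.exists_cons_of_ne_nil hl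
    exact ⟨p, fun env h => run_fstE (by rw [run, h, encodeList]), List.mem_cons_self⟩
  set q := argmax (sqDist p) l p with hq
  set A := (l.filter fun z => sqDist p z ≤ sqDist q z).reverse with hA
  set B := (l.filter fun z => sqDist q z < sqDist p z).reverse with hB
  set a := argmax (sqDist p) A p with ha
  set b := argmax (sqDist q) B q with hb
  set a' := argmax (sqCross (lineThrough p a)) A p with ha'
  set b' := argmax (sqCross (lineThrough q b)) B q with hb'
  have hmA : ∀ z, z ∈ A ↔ z ∈ l ∧ sqDist p z ≤ sqDist q z := fun z => by
    rw [hA, List.mem_reverse, List.mem_filter, decide_eq_true_iff]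
  have hmB : ∀ z, z ∈ B ↔ z ∈ l ∧ sqDist q z < sqDist p z := fun z => by
    rw [hB, List.mem_reverse, List.mem_filter, decide_eq_true_iff]
  have hAn : A.length ≤ l.length := by
    rw [hA, List.length_reverse]
    exact List.length_filter_le _ _
  have hBn : B.length ≤ l.length := by
    rw [hB, List.length_reverse]
    exact List.length_filter_le _ _
  obtain ⟨x₀, σ₁, σ₂, hs₀, hx₀, he₀⟩ := exists_evalLe_slabs (sqLen_lineThrough_pos p a)
    (sqLen_lineThrough_pos q b) l
  obtain ⟨x₁, _, _, hs₁, hx₁, hb₁, he₁⟩ := exists_evalLe_improve hs₀ p q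
  obtain ⟨x₂, _, _, hs₂, hx₂, hb₂, he₂⟩ := exists_evalLe_improve hs₁ q a
  obtain ⟨x₃, _, _, hs₃, hx₃, hb₃, he₃⟩ := exists_evalLe_improve hs₂ q a'
  obtain ⟨x₄, _, _, hs₄, hx₄, hb₄, he₄⟩ := exists_evalLe_improve hs₃ p b
  obtain ⟨x₅, ρ₁, ρ₂, hs₅, hx₅, hb₅, he₅⟩ := exists_evalLe_improve hs₄ p b'
  refine ⟨x₅, ρ₁, ρ₂, hs₅, ?_, ?_⟩
  · intro w τ₁ τ₂ hc hw₁ hw₂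
    refine le_of_candidates (A := A) (B := B) (a := a) (a' := a') (b := b) (b' := b') hc hw₁ hw₂ hp
      ?_ (le_argmax _ _ _).2 hmA hmB (argmax_mem _ _ _) (argmax_mem _ _ _)
      (argmax_mem _ _ _) (argmax_mem _ _ _) (le_argmax _ _ _).2 (le_argmax _ _ _).2
      -- The value never increases from one candidate to the next, so the last one inherits all the
      -- bounds.
      (le_argmax _ _ _).2 (le_argmax _ _ _).2 (fun τ hτ h => ?_) (hb₁.mono (by linarith))
      (hb₂.mono (by linarith)) (hb₃.mono (by linarith)) (hb₄.mono hx₅) hb₅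
    · rcases argmax_mem (sqDist p) l p with h | h
      · rw [h]
        exact hp
      · exact h
    · linarith [hx₀ τ hτ h]
  · rw [encodePoints_eq]
    refine (EvalLe.letIn (EvalLe.of_run_le 10 (by decide) (hhead _ rfl)) <|
      EvalLe.letIn (EvalLe.call_argmax (l := l) (i := p) 1000 encodePoint (sqDist p)
        (encodePoint p) (by decide) rfl (fun _ _ _ _ _ => run_sqDistE rfl rfl) ?_
        le_rfl).sndE.sndE <|
      EvalLe.letIn (u := encodeList encodePoint A) (B₁ := 1000 * (l.length + 1) + 2) ?_ <|
      EvalLe.letIn (u := encodeList encodePoint B) (B₁ := 1000 * (l.length + 1) + 2) ?_ <|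
      EvalLe.letIn (EvalLe.call 50 (by decide) rfl rfl (evalLe_cluster p A hAn)) <|
      EvalLe.letIn (EvalLe.call 50 (by decide) rfl rfl (evalLe_cluster q B hBn)) <|
      EvalLe.letIn (EvalLe.call 50 (by decide) rfl rfl he₀) <|
      EvalLe.letIn (EvalLe.call 50 (by decide) rfl rfl he₁) <|
      EvalLe.letIn (EvalLe.call 50 (by decide) rfl rfl he₂) <|
      EvalLe.letIn (EvalLe.call 50 (by decide) rfl rfl he₃) <|
      EvalLe.letIn (EvalLe.call 50 (by decide) rfl rfl he₄) <|
      EvalLe.letIn (EvalLe.call 50 (by decide) rfl rfl he₅) <|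
      EvalLe.of_run_le 50 (by decide) rfl).mono ?_
    · rw [sqDist_self]
      simp [run]
    · have := (EvalLe.call_keep (fns := twoLineFns) (f := 7) (l := l) (out := [])
        (env := [encodePoint q, encodePoint p, encodeList encodePoint l])
        (e := .pair (.pair (.pair (.var 1) (.var 0)) .nil) (.var 2)) 1000 encodePoint (sqDist p)
        (sqDist q) (.pair (encodePoint p) (encodePoint q)) (by decide) rfl
        (fun _ _ _ _ _ => run_sqDistE rfl rfl) (fun _ _ _ _ _ => run_sqDistE rfl rfl) rfl
        le_rfl).sndE
      rwa [List.append_nil] at this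
    · have := (EvalLe.call_drop (fns := twoLineFns) (f := 8) (l := l) (out := [])
        (env := [encodeList encodePoint A, encodePoint q, encodePoint p, encodeList encodePoint l])
        (e := .pair (.pair (.pair (.var 2) (.var 1)) .nil) (.var 3)) 1000 encodePoint (sqDist p)
        (sqDist q) (.pair (encodePoint p) (encodePoint q)) (by decide) rfl
        (fun _ _ _ _ _ => run_sqDistE rfl rfl) (fun _ _ _ _ _ => run_sqDistE rfl rfl) rfl
        le_rfl).sndE
      rwa [List.append_nil] at this
    · omega

end RealProg

/-! ### The theorem -/

theorem mainTheorem8 :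
    ∃ (P : RealProg.Program) (C : ℕ),
      ∀ (S : Finset (ℝ × ℝ)) (l : List (ℝ × ℝ)),
        S.Nonempty → l.Nodup → (∀ p : ℝ × ℝ, p ∈ l ↔ p ∈ S) →
          ∃ (σ₁ σ₂ : TwoLineCenter.Slab) (t : ℕ),
            P.Runs (RealProg.encodePoints l) (RealProg.encodeSlabs σ₁ σ₂) t ∧
            t ≤ C * S.card ∧
            TwoLineCenter.Covers σ₁ σ₂ (S : Set (ℝ × ℝ)) ∧
            TwoLineCenter.maxWidth σ₁ σ₂ ≤
              10 * TwoLineCenter.optWidth (S : Set (ℝ × ℝ)) := by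
  -- Twice the constant of `exists_evalLe_main`, because n + 1 ≤ 2n for n ≥ 1.
  refine ⟨⟨RealProg.twoLineFns, RealProg.twoLineMain⟩, 60000000, fun S l hS hnd hmem => ?_⟩
  have hl : l ≠ [] := by
    rintro rfl
    obtain ⟨p, hp⟩ := hS
    exact absurd ((hmem p).2 hp) (by simp)
  have hcard : l.length = S.card := by
    classical
    rw [← List.toFinset_card_of_nodup hnd]
    congr 1
    ext p
    simp [hmem]
  have hset : {z | z ∈ l} = (S : Set (ℝ × ℝ)) := Set.ext hmem
  obtain ⟨x, σ₁, σ₂, hsol, hx, t, ht, hev⟩ := RealProg.exists_evalLe_main l hl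
  rw [hset] at hx
  have hcov := hset ▸ hsol.covers
  refine ⟨σ₁, σ₂, t, hev, ?_, hcov, ?_⟩
  · have := List.length_pos_iff.2 hl
    omega
  have hle : TwoLineCenter.maxWidth σ₁ σ₂ / 10 ≤ TwoLineCenter.optWidth (S : Set (ℝ × ℝ)) := by
    refine le_csInf ⟨_, σ₁, σ₂, hcov, rfl⟩ ?_
    rintro w ⟨τ₁, τ₂, hc, rfl⟩
    have hw : 0 ≤ TwoLineCenter.maxWidth τ₁ τ₂ := le_max_of_le_left τ₁.width_nonneg
    have hx' := hx _ τ₁ τ₂ hc (le_max_left _ _) (le_max_right _ _)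
    change x ≤ 25 * TwoLineCenter.maxWidth τ₁ τ₂ ^ 2 at hx'
    rw [div_le_iff₀ (by norm_num)]
    -- The squared widths are at most 4x ≤ 100w².
    refine max_le (abs_le_of_sq_le_sq' ?_ (by positivity)).2
      (abs_le_of_sq_le_sq' ?_ (by positivity)).2
    · linarith [hsol.width_sq₁]
    · linarith [hsol.width_sq₂]
  linarith
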